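/- **Setting.** Let $S_0$ be a finite set, $\mathbb H=\{-1,0,1\}$, $\mathbb H_+=\{0,1\}$. Let $A_{k,l}$ ($k,l\in\mathbb H$), $A^{(1)}_{k,l}$ ($k\in\mathbb H,l\in\mathbb H_+$), $A^{(2)}_{k,l}$ ($k\in\mathbb H_+,l\in\mathbb H$), $A^{(0)}_{k,l}$ ($k,l\in\mathbb H_+$) be nonnegative $S_0\times S_0$ matrices such that each of the four families sums to a stochastic matrix. The 2D-QBD process is the Markov chain on $\mathbb Z_+^2\times S_0$ whose one-step transition matrix from level $(x_1,x_2)$ to level $(x_1+k,x_2+l)$ is $A_{k,l}$ if $x_1,x_2\neq0$, $A^{(1)}_{k,l}$ if $x_1\ne0=x_2$, $A^{(2)}_{k,l}$ if $x_1=0\ne x_2$, $A^{(0)}_{k,l}$ if $x_1=x_2=0$ (and $O$ for all other increments). Assume that this chain, and also the three chains on $\mathbb Z^2\times S_0$, $\mathbb Z\times\mathbb Z_+\times S_0$ and $\mathbb Z_+\times\mathbb Z\times S_0$ obtained by removing, respectively, both boundaries, the boundary $x_1=0$, and the boundary $x_2=0$, are irreducible and aperiodic, and that the 2D-QBD process has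 a stationary distribution $(\nu_{k,l,j})$; put $\boldsymbol\nu_{k,l}=(\nu_{k,l,j})_{j\in S_0}$ (row vectors). For $i=1,2$ let $r_i=e^{\xi_i}$, where $\xi_1$ is the directional decay rate $-\lim_n \frac1n\log\nu_{n,j,k}$ and $\xi_2$ is $-\lim_n\frac1n\log\nu_{j,n,k}$. (So that no existence question arises, $\xi_1$ is taken to be $\inf_{j,k}\liminf_n(-\frac1n\log\nu_{n,j,k})$, which is the limit when the limits for all $j,k$ exist and agree; likewise $\xi_2$.) Let $\mathrm{spr}$ denote the spectral radius, $C(z,w)=\sum_{k,l\in\mathbb H}A_{k,l}z^kw^l$, $\chi(z,w)=\mathrm{spr}\,C(z,w)$, $$\bar\Gamma=\{(s_1,s_2)\in\mathbb R^2:\chi(e^{s_1},e^{s_2})\le1\},\qquad \underline z_1^*=e^{\min_{\bar\Gamma}s_1},\quad \bar z_1^*=e^{\max_{\bar\Gamma}s_1},$$ and let $\underline\zeta_2(z)$ be the smallest positive $w$ with $\chi(z,w)=1$. Let $$\mathcal D_0=\{(z,w):0<z<r_1,\ 0<w<r_2,\ \mathrm{spr}\,C(z,w)<1\},$$ $$\mathcal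 D_1=\{(z,w)\in\mathbb R_+^2:\exists (z',w')\in\mathcal D_0,\ z<z',\ w<w'\}.$$ Write $A_{*,l}(z)=\sum_{k\in\mathbb H} A_{k,l}z^k$, $A^{(1)}_{*,l}(z)=\sum_{k\in\mathbb H}A^{(1)}_{k,l}z^k$, $A^{(2)}_{*,l}(z)=\sum_{k\in\mathbb H_+}A^{(2)}_{k,l}z^k$, $A^{(0)}_{*,l}(z)=\sum_{k\in\mathbb H_+}A^{(0)}_{k,l}z^k$, and, for an $S_0\times S_0$ matrix $X$, $$C_0(z,X)=A^{(0)}_{*,0}(z)+A^{(0)}_{*,1}(z)X,\quad C_1(z,X)=A^{(1)}_{*,0}(z)+A^{(1)}_{*,1}(z)X,\quad \hat C_2(z,X)=A^{(2)}_{*,-1}(z)+A^{(2)}_{*,0}(z)X+A^{(2)}_{*,1}(z)X^2,$$ $$\boldsymbol\varphi_1(z)=\sum_{i\ge1}\boldsymbol\nu_{i,0}z^i,\quad \boldsymbol\varphi_2(X)=\sum_{j\ge1}\boldsymbol\nu_{0,j}X^j,\quad \boldsymbol\varphi_2^{\hat C_2}(z,X)=\sum_{j\ge1}\boldsymbol\nu_{0,j}\hat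 C_2(z,X)X^{j-1}.$$ **Lemma 3.3.** Let $z\in[\underline z_1^*,\bar z_1^*]$ be real with $(z,\underline\zeta_2(z))\in\mathcal D_1$. Then the entrywise minimal nonnegative solution $G_1(z)$ of $A_{*,-1}(z)+A_{*,0}(z)X+A_{*,1}(z)X^2=X$ exists, the three series $\boldsymbol\varphi_1(z)$, $\boldsymbol\varphi_2(G_1(z))$, $\boldsymbol\varphi_2^{\hat C_2}(z,G_1(z))$ converge absolutely, and $$\boldsymbol\varphi_1(z)\bigl(I-C_1(z,G_1(z))\bigr)=\boldsymbol\varphi_2^{\hat C_2}(z,G_1(z))-\boldsymbol\varphi_2(G_1(z))+\boldsymbol\nu_{0,0}\bigl(C_0(z,G_1(z))-I\bigr).$$ If $z\ge1$ and $(z,\underline\zeta_2(z))\ne(1,1)$, then $I-C_1(z,G_1(z))$ is nonsingular. Whenever $I-C_1(z,G_1(z))$ is nonsingular, $$\boldsymbol\varphi_1(z)=\Bigl\{\boldsymbol\varphi_2^{\hat C_2}(z,G_1(z))-\boldsymbol\varphi_2(G_1(z))+\boldsymbol\nu_{0,0}\bigl(C_0(z,G_1(z))-I\bigr)\Bigr\}\bigl(I-C_1(z,G_1(z))\bigr)^{-1}.$$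 -/

import Mathlib

open Filter Topology
open scoped Matrix ENNReal

noncomputable section

/-- The set `{-1, 0, 1}` of increments. -/
def incH : Finset ℤ := {-1, 0, 1}

/-- The set `{0, 1}` of nonnegative increments. -/
def incHp : Finset ℤ := {0, 1}

/-- Block data of a two-dimensional quasi-birth-and-death process with finite phase set `S`.
`A k l` is used for `k, l ∈ {-1,0,1}`, `A1 k l` for `k ∈ {-1,0,1}`, `l ∈ {0,1}`, `A2 k l` for
`k ∈ {0,1}`, `l ∈ {-1,0,1}`, `A0 k l` for `k, l ∈ {0,1}`; the values at other indices are never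
used. The relevant blocks are nonnegative and their sums are stochastic. -/
structure QBD2 (S : Type*) [Fintype S] where
  A : ℤ → ℤ → Matrix S S ℝ
  A1 : ℤ → ℤ → Matrix S S ℝ
  A2 : ℤ → ℤ → Matrix S S ℝ
  A0 : ℤ → ℤ → Matrix S S ℝ
  A_nonneg : ∀ k ∈ incH, ∀ l ∈ incH, ∀ i j, 0 ≤ A k l i j
  A1_nonneg : ∀ k ∈ incH, ∀ l ∈ incHp, ∀ i j, 0 ≤ A1 k l i j
  A2_nonneg : ∀ k ∈ incHp, ∀ l ∈ incH, ∀ i j, 0 ≤ A2 k l i j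
  A0_nonneg : ∀ k ∈ incHp, ∀ l ∈ incHp, ∀ i j, 0 ≤ A0 k l i j
  A_stoch : ∀ i, ∑ j, (∑ k ∈ incH, ∑ l ∈ incH, A k l) i j = 1
  A1_stoch : ∀ i, ∑ j, (∑ k ∈ incH, ∑ l ∈ incHp, A1 k l) i j = 1
  A2_stoch : ∀ i, ∑ j, (∑ k ∈ incHp, ∑ l ∈ incH, A2 k l) i j = 1
  A0_stoch : ∀ i, ∑ j, (∑ k ∈ incHp, ∑ l ∈ incHp, A0 k l) i j = 1

/-! ### Irreducibility and aperiodicity of a transition kernel on a countable set -/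

/-- `y` is reached from `x` in exactly `n` steps with positive probability. -/
def ReachIn {α : Type*} (p : α → α → ℝ) : ℕ → α → α → Prop
  | 0, x, y => x = y
  | n + 1, x, y => ∃ u, 0 < p x u ∧ ReachIn p n u y

def ChainIrreducible {α : Type*} (p : α → α → ℝ) : Prop :=
  ∀ x y, ∃ n, ReachIn p n x y

/-- Every state has period one: the greatest common divisor of its possible return times is `1`. -/
def ChainAperiodic {α : Type*} (p : α → α → ℝ) : Prop :=
  ∀ x, ∀ d : ℕ, (∀ n, 1 ≤ n → ReachIn p n x x → d ∣ n) → d = 1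

/-- Spectral radius (maximal modulus of a complex eigenvalue) of a real square matrix. -/
def spr {S : Type*} [Fintype S] [DecidableEq S] (M : Matrix S S ℝ) : ℝ :=
  (spectralRadius ℂ (M.map (fun x : ℝ => (x : ℂ)))).toReal

namespace QBD2

variable {S : Type*} [Fintype S]

/-- Transition probabilities of the process on `ℤ₊ × ℤ₊ × S`. -/
def P (M : QBD2 S) (x y : ℕ × ℕ × S) : ℝ :=
  let d1 : ℤ := (y.1 : ℤ) - x.1
  let d2 : ℤ := (y.2.1 : ℤ) - x.2.1
  if x.1 ≠ 0 then
    if x.2.1 ≠ 0 then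
      if d1 ∈ incH ∧ d2 ∈ incH then M.A d1 d2 x.2.2 y.2.2 else 0
    else
      if d1 ∈ incH ∧ d2 ∈ incHp then M.A1 d1 d2 x.2.2 y.2.2 else 0
  else
    if x.2.1 ≠ 0 then
      if d1 ∈ incHp ∧ d2 ∈ incH then M.A2 d1 d2 x.2.2 y.2.2 else 0
    else
      if d1 ∈ incHp ∧ d2 ∈ incHp then M.A0 d1 d2 x.2.2 y.2.2 else 0

/-- Transition probabilities on `ℤ × ℤ × S`, both boundaries removed. -/
def PFree (M : QBD2 S) (x y : ℤ × ℤ × S) : ℝ :=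
  let d1 : ℤ := y.1 - x.1
  let d2 : ℤ := y.2.1 - x.2.1
  if d1 ∈ incH ∧ d2 ∈ incH then M.A d1 d2 x.2.2 y.2.2 else 0

/-- Transition probabilities on `ℤ × ℤ₊ × S`, the boundary `x₁ = 0` removed. -/
def PFree1 (M : QBD2 S) (x y : ℤ × ℕ × S) : ℝ :=
  let d1 : ℤ := y.1 - x.1
  let d2 : ℤ := (y.2.1 : ℤ) - x.2.1
  if x.2.1 ≠ 0 then
    if d1 ∈ incH ∧ d2 ∈ incH then M.A d1 d2 x.2.2 y.2.2 else 0
  else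
    if d1 ∈ incH ∧ d2 ∈ incHp then M.A1 d1 d2 x.2.2 y.2.2 else 0

/-- Transition probabilities on `ℤ₊ × ℤ × S`, the boundary `x₂ = 0` removed. -/
def PFree2 (M : QBD2 S) (x y : ℕ × ℤ × S) : ℝ :=
  let d1 : ℤ := (y.1 : ℤ) - x.1
  let d2 : ℤ := y.2.1 - x.2.1
  if x.1 ≠ 0 then
    if d1 ∈ incH ∧ d2 ∈ incH then M.A d1 d2 x.2.2 y.2.2 else 0
  else
    if d1 ∈ incHp ∧ d2 ∈ incH then M.A2 d1 d2 x.2.2 y.2.2 else 0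

/-- `ν` is a stationary distribution of the process; `ν k l j` is the mass of `(k, l, j)`. -/
structure IsStationary (M : QBD2 S) (ν : ℕ → ℕ → S → ℝ) : Prop where
  nonneg : ∀ k l j, 0 ≤ ν k l j
  hasSum_one : HasSum (fun x : ℕ × ℕ × S => ν x.1 x.2.1 x.2.2) 1
  invariant : ∀ y : ℕ × ℕ × S,
    HasSum (fun x : ℕ × ℕ × S => ν x.1 x.2.1 x.2.2 * M.P x y) (ν y.1 y.2.1 y.2.2)

/-! ### Matrix generating functions of the blocks -/

/-- `A_{*,l}(z) = ∑_{k ∈ {-1,0,1}} A_{k,l} z^k`. -/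
def colA (M : QBD2 S) (l : ℤ) (z : ℝ) : Matrix S S ℝ := ∑ k ∈ incH, z ^ k • M.A k l

def colA1 (M : QBD2 S) (l : ℤ) (z : ℝ) : Matrix S S ℝ := ∑ k ∈ incH, z ^ k • M.A1 k l

def colA2 (M : QBD2 S) (l : ℤ) (z : ℝ) : Matrix S S ℝ := ∑ k ∈ incHp, z ^ k • M.A2 k l

def colA0 (M : QBD2 S) (l : ℤ) (z : ℝ) : Matrix S S ℝ := ∑ k ∈ incHp, z ^ k • M.A0 k l

/-- `C(z,w) = ∑_{k,l ∈ {-1,0,1}} A_{k,l} z^k w^l`. -/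
def C (M : QBD2 S) (z w : ℝ) : Matrix S S ℝ :=
  ∑ k ∈ incH, ∑ l ∈ incH, (z ^ k * w ^ l) • M.A k l

variable [DecidableEq S]

/-- `C₀(z,X) = A⁽⁰⁾_{*,0}(z) + A⁽⁰⁾_{*,1}(z) X`. -/
def C0 (M : QBD2 S) (z : ℝ) (X : Matrix S S ℝ) : Matrix S S ℝ := M.colA0 0 z + M.colA0 1 z * X

/-- `C₁(z,X) = A⁽¹⁾_{*,0}(z) + A⁽¹⁾_{*,1}(z) X`. -/
def C1 (M : QBD2 S) (z : ℝ) (X : Matrix S S ℝ) : Matrix S S ℝ := M.colA1 0 z + M.colA1 1 z * X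

/-- `Ĉ₂(z,X) = A⁽²⁾_{*,-1}(z) + A⁽²⁾_{*,0}(z) X + A⁽²⁾_{*,1}(z) X²`. -/
def C2hat (M : QBD2 S) (z : ℝ) (X : Matrix S S ℝ) : Matrix S S ℝ :=
  M.colA2 (-1) z + M.colA2 0 z * X + M.colA2 1 z * X ^ 2

/-! ### The curve `χ = 1` -/

/-- `χ(z,w)`, the spectral radius of `C(z,w)`. -/
def chi (M : QBD2 S) (z w : ℝ) : ℝ := spr (M.C z w)

/-- The closed set of `(s₁,s₂)` with `χ(e^{s₁}, e^{s₂}) ≤ 1`. -/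
def Gam (M : QBD2 S) : Set (ℝ × ℝ) := {s | M.chi (Real.exp s.1) (Real.exp s.2) ≤ 1}

/-- The lower extreme point `e^{min s₁}` of the closed set in the first coordinate. -/
def zLow1 (M : QBD2 S) : ℝ := Real.exp (sInf (Prod.fst '' M.Gam))

/-- The upper extreme point `e^{max s₁}` of the closed set in the first coordinate. -/
def zHigh1 (M : QBD2 S) : ℝ := Real.exp (sSup (Prod.fst '' M.Gam))

/-- The smaller of the positive solutions `w` of `χ(z,w) = 1`. -/
def zetaLow2 (M : QBD2 S) (z : ℝ) : ℝ := sInf {w : ℝ | 0 < w ∧ M.chi z w = 1}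

/-! ### The minimal nonnegative solution -/

/-- `X` is an entrywise nonnegative solution of
`A_{*,-1}(z) + A_{*,0}(z) X + A_{*,1}(z) X² = X`. -/
def IsNonnegSol1 (M : QBD2 S) (z : ℝ) (X : Matrix S S ℝ) : Prop :=
  (∀ i j, 0 ≤ X i j) ∧ M.colA (-1) z + M.colA 0 z * X + M.colA 1 z * X ^ 2 = X

/-- `G` is the entrywise smallest nonnegative solution. There is at most one such `G`. -/
def IsG1 (M : QBD2 S) (z : ℝ) (G : Matrix S S ℝ) : Prop :=
  M.IsNonnegSol1 z G ∧ ∀ X, M.IsNonnegSol1 z X → ∀ i j, G i j ≤ X i j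

end QBD2

/-! ### Decay rates and the convergence domain -/

section Decay

variable {S : Type*}

/-- Directional decay rate of `ν` in the first coordinate: the common limit over all `(j,k)` of
`-(1/n) log ν_{n,j,k}`, written as a lower limit so that it makes sense unconditionally. -/
def decayRate1 (ν : ℕ → ℕ → S → ℝ) : EReal :=
  ⨅ j : ℕ, ⨅ k : S, liminf (fun n : ℕ => ((-(Real.log (ν n j k)) / n : ℝ) : EReal)) atTop

/-- Directional decay rate of `ν` in the second coordinate. -/
def decayRate2 (ν : ℕ → ℕ → S → ℝ) : EReal :=
  ⨅ i : ℕ, ⨅ k : S, liminf (fun n : ℕ => ((-(Real.log (ν i n k)) / n : ℝ) : EReal)) atTop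

/-- The geometric decay rate `r₁ = e^{ξ₁}`. -/
def geomRate1 (ν : ℕ → ℕ → S → ℝ) : ℝ≥0∞ := EReal.exp (decayRate1 ν)

/-- The geometric decay rate `r₂ = e^{ξ₂}`. -/
def geomRate2 (ν : ℕ → ℕ → S → ℝ) : ℝ≥0∞ := EReal.exp (decayRate2 ν)

end Decay

namespace QBD2

variable {S : Type*} [Fintype S] [DecidableEq S]

/-- `D₀ = {(z,w) : 0 < z < r₁, 0 < w < r₂, spr C(z,w) < 1}`. -/
def D0 (M : QBD2 S) (ν : ℕ → ℕ → S → ℝ) : Set (ℝ × ℝ) :=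
  {q | 0 < q.1 ∧ ENNReal.ofReal q.1 < geomRate1 ν ∧
       0 < q.2 ∧ ENNReal.ofReal q.2 < geomRate2 ν ∧ spr (M.C q.1 q.2) < 1}

/-- `D₁`: the points of the closed quadrant strictly dominated by a point of `D₀`. -/
def D1 (M : QBD2 S) (ν : ℕ → ℕ → S → ℝ) : Set (ℝ × ℝ) :=
  {q | 0 ≤ q.1 ∧ 0 ≤ q.2 ∧ ∃ q' ∈ M.D0 ν, q.1 < q'.1 ∧ q.2 < q'.2}

end QBD2

/-! ### Vector generating functions -/

section GenFun

variable {S : Type*}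

/-- Terms `ν_{i,0} z^i`, `i ≥ 1` (indexed by `i - 1`), of `φ₁(z)`. -/
def phi1Term (ν : ℕ → ℕ → S → ℝ) (z : ℝ) (i : ℕ) : S → ℝ := z ^ (i + 1) • ν (i + 1) 0

/-- `φ₁(z) = ∑_{i ≥ 1} ν_{i,0} z^i`. -/
def phi1 (ν : ℕ → ℕ → S → ℝ) (z : ℝ) : S → ℝ := ∑' i, phi1Term ν z i

variable [Fintype S] [DecidableEq S]

/-- Terms `ν_{0,j} X^j`, `j ≥ 1` (indexed by `j - 1`), of `φ₂(X)`. -/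
def phi2Term (ν : ℕ → ℕ → S → ℝ) (X : Matrix S S ℝ) (j : ℕ) : S → ℝ :=
  ν 0 (j + 1) ᵥ* X ^ (j + 1)

/-- `φ₂(X) = ∑_{j ≥ 1} ν_{0,j} X^j`. -/
def phi2 (ν : ℕ → ℕ → S → ℝ) (X : Matrix S S ℝ) : S → ℝ := ∑' j, phi2Term ν X j

/-- Terms `ν_{0,j} Ĉ₂(z,X) X^{j-1}`, `j ≥ 1` (indexed by `j - 1`). -/
def phi2C2hatTerm (M : QBD2 S) (ν : ℕ → ℕ → S → ℝ) (z : ℝ) (X : Matrix S S ℝ) (j : ℕ) :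
    S → ℝ :=
  ν 0 (j + 1) ᵥ* (M.C2hat z X * X ^ j)

/-- `∑_{j ≥ 1} ν_{0,j} Ĉ₂(z,X) X^{j-1}`. -/
def phi2C2hat (M : QBD2 S) (ν : ℕ → ℕ → S → ℝ) (z : ℝ) (X : Matrix S S ℝ) : S → ℝ :=
  ∑' j, phi2C2hatTerm M ν z X j

end GenFun

end

/-! ### Stochastic kernels with finite rows -/

section Kernel

variable {α : Type*} {p : α → α → ℝ}

/-- The expectation of `f` after one step of the kernel `p` started at `x`. -/
noncomputable def kernelMean (p : α → α → ℝ) (f : α → ℝ) (x : α) : ℝ := ∑' y, p x y * f y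

/-- Nonnegative kernels with finitely supported rows of total mass one. -/
structure IsFiniteStochastic (p : α → α → ℝ) : Prop where
  nonneg : ∀ x y, 0 ≤ p x y
  finite_support : ∀ x, (Function.support (p x)).Finite
  tsum_eq_one : ∀ x, ∑' y, p x y = 1

theorem ReachIn.exists_pos_mul_le {n : ℕ} {x y : α} (h : ReachIn p n x y) :
    ∃ c > 0, ∀ V : α → ℝ, (∀ x y, p x y * V y ≤ V x) → c * V y ≤ V x := by
  induction n generalizing x with
  | zero => exact ⟨1, one_pos, fun V _ => by rw [show x = y from h, one_mul]⟩
  | succ n ih =>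
    obtain ⟨u, hu, hr⟩ := h
    obtain ⟨c, hc, H⟩ := ih hr
    refine ⟨p x u * c, mul_pos hu hc, fun V hV => ?_⟩
    calc p x u * c * V y = p x u * (c * V y) := by ring
      _ ≤ p x u * V u := mul_le_mul_of_nonneg_left (H V hV) hu.le
      _ ≤ V x := hV x u

theorem ReachIn.induction_forward {n : ℕ} {x y : α} (h : ReachIn p n x y) {Q : α → Prop}
    (hQ : ∀ x y, 0 < p x y → Q x → Q y) (hx : Q x) : Q y := by
  induction n generalizing x with
  | zero => exact (show x = y from h) ▸ hx
  | succ n ih =>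
    obtain ⟨u, hu, hr⟩ := h
    exact ih hr (hQ x u hu hx)

theorem kernelMean_const_mul (p : α → α → ℝ) (c : ℝ) (f : α → ℝ) (x : α) :
    kernelMean p (fun y => c * f y) x = c * kernelMean p f x := by
  simp only [kernelMean, ← tsum_mul_left]
  exact tsum_congr fun y => by ring

namespace IsFiniteStochastic

variable (hp : IsFiniteStochastic p)
include hp

theorem summable_mul (f : α → ℝ) (x : α) : Summable (fun y => p x y * f y) :=
  summable_of_hasFiniteSupport <| (hp.finite_support x).subset fun y hy => by
    simp only [Function.mem_support] at hy ⊢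
    exact left_ne_zero_of_mul hy

theorem kernelMean_mono {f g : α → ℝ} (h : ∀ y, f y ≤ g y) (x : α) :
    kernelMean p f x ≤ kernelMean p g x :=
  (hp.summable_mul f x).tsum_le_tsum (fun y => mul_le_mul_of_nonneg_left (h y) (hp.nonneg x y))
    (hp.summable_mul g x)

theorem kernelMean_const (c : ℝ) (x : α) : kernelMean p (fun _ => c) x = c := by
  rw [kernelMean, tsum_mul_right, hp.tsum_eq_one, one_mul]

theorem kernelMean_sub (f g : α → ℝ) (x : α) :
    kernelMean p (fun y => f y - g y) x = kernelMean p f x - kernelMean p g x := by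
  simp only [kernelMean, mul_sub]
  exact (hp.summable_mul f x).tsum_sub (hp.summable_mul g x)

theorem mul_le_kernelMean {f : α → ℝ} (hf : ∀ y, 0 ≤ f y) (x y : α) :
    p x y * f y ≤ kernelMean p f x :=
  (hp.summable_mul f x).le_tsum y fun z _ => mul_nonneg (hp.nonneg x z) (hf z)

/-- Equality case of the comparison of expectations. -/
theorem eq_of_kernelMean_le {f g : α → ℝ} {x y : α} (h : ∀ y, f y ≤ g y)
    (hx : kernelMean p g x ≤ kernelMean p f x) (hy : 0 < p x y) : f y = g y := by
  have h1 := hp.mul_le_kernelMean (f := fun y => g y - f y) (fun y => sub_nonneg.2 (h y)) x y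
  rw [hp.kernelMean_sub] at h1
  have h2 : p x y * (g y - f y) ≤ 0 := h1.trans (by linarith)
  have h3 : g y - f y ≤ 0 := nonpos_of_mul_nonpos_right h2 hy
  linarith [h y]

variable {ν : α → ℝ} (hν : ∀ x, 0 ≤ ν x) (hinv : ∀ y, HasSum (fun x => ν x * p x y) (ν y))
include hν hinv

theorem hasSum_mul_kernelMean {f : α → ℝ} (hf : Summable fun x => ν x * |f x|) :
    HasSum (fun x => ν x * kernelMean p f x) (∑' x, ν x * f x) := by
  have hF : Summable (fun q : α × α => ν q.2 * p q.2 q.1 * f q.1) := by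
    rw [← summable_abs_iff]
    refine (summable_prod_of_nonneg fun q => abs_nonneg _).2 ⟨fun y => ?_, ?_⟩
    · exact ((hinv y).summable.mul_right (f y)).abs
    · refine hf.congr fun y => ?_
      have : ∀ x, |ν x * p x y * f y| = ν x * p x y * |f y| := fun x => by
        rw [abs_mul, abs_of_nonneg (mul_nonneg (hν x) (hp.nonneg x y))]
      simp only [this]
      rw [tsum_mul_right, (hinv y).tsum_eq]
  have h1 := hF.hasSum.prod_fiberwise (g := fun y => ν y * f y) fun y => (hinv y).mul_right (f y)
  have h2 := ((Equiv.prodComm α α).hasSum_iff.2 hF.hasSum).prod_fiberwise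
    (g := fun x => ν x * kernelMean p f x) fun x => by
      have := (hp.summable_mul f x).hasSum.mul_left (ν x)
      simp only [← mul_assoc] at this
      exact this
  rw [h1.tsum_eq]
  exact h2

/-- A moment bound of Foster–Lyapunov type. -/
theorem summable_of_drift (hνs : Summable ν) {V β : α → ℝ} {ρ : ℝ} (hV : ∀ x, 0 ≤ V x)
    (hβ : ∀ x, 0 ≤ β x) (hρ1 : ρ < 1)
    (hβs : Summable fun x => ν x * β x)
    (hdrift : ∀ x, kernelMean p V x ≤ ρ * V x + β x) : Summable fun x => ν x * V x := by
  have key : ∀ F : Finset α, ∑ x ∈ F, ν x * V x ≤ (∑' x, ν x * β x) / (1 - ρ) := by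
    intro F
    obtain ⟨N, hN⟩ : ∃ N : ℝ, 0 ≤ N ∧ ∀ x ∈ F, V x ≤ N :=
      ⟨∑ x ∈ F, V x, Finset.sum_nonneg fun x _ => hV x,
        fun x hx => Finset.single_le_sum (f := V) (fun y _ => hV y) hx⟩
    have hf0 : ∀ x, 0 ≤ min (V x) N := fun x => le_min (hV x) hN.1
    have hfs : Summable fun x => ν x * |min (V x) N| :=
      Summable.of_nonneg_of_le (fun x => mul_nonneg (hν x) (abs_nonneg _))
        (fun x => by
          rw [abs_of_nonneg (hf0 x)]
          exact mul_le_mul_of_nonneg_left (min_le_right _ _) (hν x)) (hνs.mul_right N)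
    have hfs' : Summable fun x => ν x * min (V x) N :=
      hfs.congr fun x => by rw [abs_of_nonneg (hf0 x)]
    have h1 := hp.hasSum_mul_kernelMean hν hinv hfs
    have h2 : HasSum (fun x => ν x * β x + (ν x * min (V x) N
        - ν x * kernelMean p (fun x => min (V x) N) x)) (∑' x, ν x * β x) := by
      simpa using hβs.hasSum.add (hfs'.hasSum.sub h1)
    have hm : ∀ x, min (V x) N - min (ρ * V x) N
        ≤ β x + (min (V x) N - kernelMean p (fun x => min (V x) N) x) := by
      intro x
      have a1 : kernelMean p (fun x => min (V x) N) x ≤ ρ * V x + β x :=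
        (hp.kernelMean_mono (fun y => min_le_left _ _) x).trans (hdrift x)
      have a2 : kernelMean p (fun x => min (V x) N) x ≤ N :=
        (hp.kernelMean_mono (fun y => min_le_right _ _) x).trans (hp.kernelMean_const N x).le
      have a3 : kernelMean p (fun x => min (V x) N) x ≤ min (ρ * V x) N + β x := by
        rw [← min_add_add_right]
        exact le_min a1 (a2.trans (le_add_of_nonneg_right (hβ x)))
      linarith
    have hm0 : ∀ x, 0 ≤ min (V x) N - min (ρ * V x) N := fun x =>
      sub_nonneg.2 (min_le_min_right _ (mul_le_of_le_one_left (hV x) hρ1.le))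
    have h3 : ∑ x ∈ F, ν x * ((1 - ρ) * V x) ≤ ∑' x, ν x * β x := by
      calc ∑ x ∈ F, ν x * ((1 - ρ) * V x)
          ≤ ∑ x ∈ F, (ν x * β x + (ν x * min (V x) N
            - ν x * kernelMean p (fun x => min (V x) N) x)) := by
            refine Finset.sum_le_sum fun x hx => ?_
            have b1 : min (V x) N = V x := min_eq_left (hN.2 x hx)
            have b2 : min (ρ * V x) N = ρ * V x :=
              min_eq_left ((mul_le_of_le_one_left (hV x) hρ1.le).trans (hN.2 x hx))
            have := mul_le_mul_of_nonneg_left (hm x) (hν x)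
            rw [b1, b2] at this
            rw [b1]
            nlinarith
        _ ≤ ∑' x, ν x * β x := by
            refine sum_le_hasSum F (fun x _ => ?_) h2
            have := mul_nonneg (hν x) ((hm0 x).trans (hm x))
            nlinarith
    rw [le_div_iff₀ (by linarith), Finset.sum_mul]
    refine le_trans (le_of_eq (Finset.sum_congr rfl fun x _ => by ring)) h3
  exact summable_of_sum_le (fun x => mul_nonneg (hν x) (hV x)) key

/-- An integrable submartingale which is bounded below by one of its values is constant along
the paths leaving a state where it has this value. -/
theorem eq_of_reachIn (hν0 : ∀ x, 0 < ν x) {g : α → ℝ} {N : ℝ}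
    (hgN : ∀ x, N ≤ g x) (hg : ∀ x, g x ≤ kernelMean p g x)
    (hgs : Summable fun x => ν x * |g x|) {n : ℕ} {x y : α} (h : ReachIn p n x y)
    (hx : g x = N) : g y = N := by
  have h1 := hp.hasSum_mul_kernelMean hν hinv hgs
  have hgs' : Summable fun x => ν x * g x := by
    refine Summable.of_norm (hgs.congr fun x => ?_)
    rw [Real.norm_eq_abs, abs_mul, abs_of_nonneg (hν x)]
  have h2 : HasSum (fun x => ν x * kernelMean p g x - ν x * g x) 0 := by
    simpa using h1.sub hgs'.hasSum
  have h3 : ∀ x, kernelMean p g x = g x := by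
    intro x
    have := (hasSum_zero_iff_of_nonneg (fun x => by
      have := mul_le_mul_of_nonneg_left (hg x) (hν x)
      simpa using this)).1 h2
    have h4 := congrFun this x
    simp only [Pi.zero_apply, ← mul_sub] at h4
    have := (mul_eq_zero.1 h4).resolve_left (hν0 x).ne'
    linarith
  refine h.induction_forward (Q := fun y => g y = N) (fun a b hab ha => ?_) hx
  refine (hp.eq_of_kernelMean_le (f := fun _ => N) hgN ?_ hab).symm
  rw [h3, hp.kernelMean_const, ha]

end IsFiniteStochastic

end Kernel

/-! ### Spectral radius of nonnegative matrices -/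

section Spr

variable {S : Type*} [Fintype S] [DecidableEq S]

theorem spr_le_of_mulVec_le {M : Matrix S S ℝ} {h : S → ℝ} {ρ : ℝ} (hM : ∀ i j, 0 ≤ M i j)
    (hh : ∀ i, 0 < h i) (hρ : 0 ≤ ρ) (hle : ∀ i, (M *ᵥ h) i ≤ ρ * h i) : spr M ≤ ρ := by
  have key : spectralRadius ℂ (M.map (fun x : ℝ => (x : ℂ))) ≤ ENNReal.ofReal ρ := by
    refine iSup₂_le fun μ hμ => ?_
    have hdet : (algebraMap ℂ (Matrix S S ℂ) μ - M.map (fun x : ℝ => (x : ℂ))).det = 0 := by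
      by_contra hne
      exact hμ ((Matrix.isUnit_iff_isUnit_det _).2 (isUnit_iff_ne_zero.2 hne))
    obtain ⟨v, hv0, hv⟩ := Matrix.exists_mulVec_eq_zero_iff.2 hdet
    have hv' : ∀ i, ∑ j, (M i j : ℂ) * v j = μ * v i := by
      intro i
      have := congrFun hv i
      rw [Matrix.sub_mulVec, Algebra.algebraMap_eq_smul_one, Matrix.smul_mulVec,
        Matrix.one_mulVec] at this
      simp only [Pi.sub_apply, Pi.smul_apply, smul_eq_mul, Pi.zero_apply, Matrix.mulVec,
        dotProduct, Matrix.map_apply] at this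
      rw [sub_eq_zero] at this
      exact this.symm
    obtain ⟨i0, hi0⟩ := Function.ne_iff.1 hv0
    obtain ⟨i, -, hi⟩ := Finset.exists_max_image Finset.univ (fun i => ‖v i‖ / h i)
      ⟨i0, Finset.mem_univ _⟩
    set m := ‖v i‖ / h i with hm
    have hmpos : 0 < m := lt_of_lt_of_le (div_pos (norm_pos_iff.2 hi0) (hh i0))
      (hi i0 (Finset.mem_univ _))
    have hvm : ∀ j, ‖v j‖ ≤ m * h j := fun j =>
      (div_le_iff₀ (hh j)).1 (hi j (Finset.mem_univ _))
    have hvi : ‖v i‖ = m * h i := by rw [hm, div_mul_cancel₀ _ (hh i).ne']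
    have h1 : ‖μ‖ * (m * h i) ≤ ρ * (m * h i) := by
      calc ‖μ‖ * (m * h i) = ‖∑ j, (M i j : ℂ) * v j‖ := by rw [hv', norm_mul, hvi]
        _ ≤ ∑ j, ‖(M i j : ℂ) * v j‖ := norm_sum_le _ _
        _ ≤ ∑ j, M i j * (m * h j) := by
            refine Finset.sum_le_sum fun j _ => ?_
            rw [norm_mul, Complex.norm_real, Real.norm_of_nonneg (hM i j)]
            exact mul_le_mul_of_nonneg_left (hvm j) (hM i j)
        _ = m * (M *ᵥ h) i := by
            rw [Matrix.mulVec, dotProduct, Finset.mul_sum]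
            exact Finset.sum_congr rfl fun j _ => by ring
        _ ≤ m * (ρ * h i) := mul_le_mul_of_nonneg_left (hle i) hmpos.le
        _ = ρ * (m * h i) := by ring
    have h2 : ‖μ‖ ≤ ρ := le_of_mul_le_mul_right h1 (mul_pos hmpos (hh i))
    rw [← ENNReal.ofReal_coe_nnreal]
    exact ENNReal.ofReal_le_ofReal h2
  exact ENNReal.toReal_le_of_le_ofReal hρ key

theorem spr_lt_one_of_mulVec_lt {M : Matrix S S ℝ} {h : S → ℝ} (hM : ∀ i j, 0 ≤ M i j)
    (hh : ∀ i, 0 < h i) (hlt : ∀ i, (M *ᵥ h) i < h i) : spr M < 1 := by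
  have hMh : ∀ i, 0 ≤ (M *ᵥ h) i := fun i =>
    Finset.sum_nonneg fun j _ => mul_nonneg (hM i j) (hh j).le
  rcases isEmpty_or_nonempty S with hS | hS
  · exact (spr_le_of_mulVec_le hM hh le_rfl (fun i => hS.elim i)).trans_lt one_pos
  · obtain ⟨i, -, hi⟩ := Finset.exists_max_image Finset.univ (fun i => (M *ᵥ h) i / h i)
      Finset.univ_nonempty
    refine (spr_le_of_mulVec_le hM hh (div_nonneg (hMh i) (hh i).le) fun j => ?_).trans_lt
      ((div_lt_one (hh i)).2 (hlt i))
    exact (div_le_iff₀ (hh j)).1 (hi j (Finset.mem_univ _))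

section Gelfand

attribute [local instance] Matrix.linftyOpNormedRing Matrix.linftyOpNormedAlgebra

theorem exists_pow_row_sum_lt [Nonempty S] {M : Matrix S S ℝ} {c : ℝ}
    (hc : spr M < c) : ∃ n : ℕ, ∀ i, ((M ^ (n + 1)) *ᵥ fun _ => 1) i < c ^ (n + 1) := by
  set a : Matrix S S ℂ := M.map (fun x : ℝ => (x : ℂ)) with ha
  have hc0 : 0 < c := lt_of_le_of_lt ENNReal.toReal_nonneg hc
  have hfin : spectralRadius ℂ a ≠ ⊤ :=
    ne_top_of_le_ne_top ENNReal.coe_ne_top (spectrum.spectralRadius_le_nnnorm a)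
  have hlt : spectralRadius ℂ a < ENNReal.ofReal c :=
    (ENNReal.lt_ofReal_iff_toReal_lt hfin).2 hc
  have hev :=
    (spectrum.pow_nnnorm_pow_one_div_tendsto_nhds_spectralRadius a).eventually_lt_const hlt
  obtain ⟨n, hn, hn1⟩ := (hev.and (eventually_ge_atTop 1)).exists
  obtain ⟨n, rfl⟩ : ∃ m, n = m + 1 := ⟨n - 1, by omega⟩
  refine ⟨n, fun i => ?_⟩
  have hnorm : ‖a ^ (n + 1)‖ < c ^ (n + 1) := by
    have h1 := ENNReal.rpow_lt_rpow hn (show (0 : ℝ) < ((n + 1 : ℕ) : ℝ) by positivity)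
    rw [← ENNReal.rpow_mul, one_div, inv_mul_cancel₀ (by positivity), ENNReal.rpow_one,
      ENNReal.rpow_natCast, ← ENNReal.ofReal_pow hc0.le, ← ENNReal.ofReal_coe_nnreal] at h1
    exact (ENNReal.ofReal_lt_ofReal_iff (pow_pos hc0 _)).1 h1
  refine lt_of_le_of_lt ?_ hnorm
  have hmap : a ^ (n + 1) = (M ^ (n + 1)).map (fun x : ℝ => (x : ℂ)) := by
    rw [ha]
    exact (Matrix.map_pow (f := Complex.ofRealHom) M (n + 1)).symm
  have hrow : ∑ j, ‖(a ^ (n + 1)) i j‖₊ ≤ ‖a ^ (n + 1)‖₊ := by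
    rw [Matrix.linfty_opNNNorm_def]
    exact Finset.le_sup (f := fun i => ∑ j, ‖(a ^ (n + 1)) i j‖₊) (Finset.mem_univ i)
  have hrow' : ∑ j, ‖(a ^ (n + 1)) i j‖ ≤ ‖a ^ (n + 1)‖ := by
    have := NNReal.coe_le_coe.2 hrow
    rwa [NNReal.coe_sum] at this
  refine le_trans ?_ hrow'
  rw [Matrix.mulVec, dotProduct]
  refine Finset.sum_le_sum fun j _ => ?_
  rw [hmap, Matrix.map_apply, Complex.norm_real, mul_one]
  exact le_abs_self _

end Gelfand

theorem exists_mulVec_lt_of_spr_lt [Nonempty S] {M : Matrix S S ℝ} (hM : ∀ i j, 0 ≤ M i j)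
    {c : ℝ} (hc : spr M < c) : ∃ h : S → ℝ, (∀ i, 0 < h i) ∧ ∀ i, (M *ᵥ h) i < c * h i := by
  obtain ⟨n, hn⟩ := exists_pow_row_sum_lt hc
  have hc0 : 0 < c := lt_of_le_of_lt ENNReal.toReal_nonneg hc
  have key : ∀ m : ℕ, ∃ g : S → ℝ, (∀ i, 0 < g i) ∧
      M *ᵥ g + (fun _ => c ^ (m + 1)) = c • g + (M ^ (m + 1)) *ᵥ fun _ => 1 := by
    intro m
    induction m with
    | zero => exact ⟨fun _ => 1, fun _ => one_pos, by ext i; simp [add_comm]⟩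
    | succ m ih =>
      obtain ⟨g, hg, he⟩ := ih
      refine ⟨c • g + (M ^ (m + 1)) *ᵥ fun _ => 1, fun i => ?_, ?_⟩
      · refine add_pos_of_pos_of_nonneg (mul_pos hc0 (hg i)) ?_
        exact Finset.sum_nonneg fun j _ => mul_nonneg (Matrix.pow_apply_nonneg hM _ i j) zero_le_one
      · rw [Matrix.mulVec_add, Matrix.mulVec_smul, Matrix.mulVec_mulVec, ← pow_succ', ← he]
        ext i
        simp only [Pi.add_apply, Pi.smul_apply, smul_eq_mul]
        ring
  obtain ⟨g, hg, he⟩ := key n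
  refine ⟨g, hg, fun i => ?_⟩
  have h1 := congrFun he i
  simp only [Pi.add_apply, Pi.smul_apply, smul_eq_mul] at h1
  linarith [hn i]

end Spr

/-! ### The region of positive subinvariant vectors of `C(z,w)` -/

theorem exists_rpow_mul_rpow_eq {a b z : ℝ} (ha : 0 < a) (haz : a < z) (hzb : z ≤ b) :
    ∃ t : ℝ, 0 < t ∧ t ≤ 1 ∧ a ^ (1 - t) * b ^ t = z := by
  have hz : 0 < z := ha.trans haz
  have hb : 0 < b := hz.trans_le hzb
  have h1 : Real.log a < Real.log z := Real.log_lt_log ha haz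
  have h2 : Real.log z ≤ Real.log b := Real.log_le_log hz hzb
  have h3 : Real.log b - Real.log a ≠ 0 := by linarith
  refine ⟨(Real.log z - Real.log a) / (Real.log b - Real.log a),
    div_pos (by linarith) (by linarith), (div_le_one (by linarith)).2 (by linarith), ?_⟩
  rw [Real.rpow_def_of_pos ha, Real.rpow_def_of_pos hb, ← Real.exp_add]
  conv_rhs => rw [← Real.exp_log hz]
  congr 1
  field_simp
  ring

namespace QBD2

variable {S : Type*} [Fintype S] (M : QBD2 S)

/-- The index set of the terms of an entry of `C(z,w) h`. -/
def stepIndex (S : Type*) [Fintype S] : Finset (ℤ × ℤ × S) := incH ×ˢ incH ×ˢ Finset.univ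

theorem C_mulVec_apply (z w : ℝ) (h : S → ℝ) (i : S) :
    (M.C z w *ᵥ h) i =
      ∑ q ∈ stepIndex S, M.A q.1 q.2.1 i q.2.2 * (z ^ q.1 * w ^ q.2.1 * h q.2.2) := by
  rw [stepIndex, Finset.sum_product, C, Matrix.sum_mulVec, Finset.sum_apply]
  refine Finset.sum_congr rfl fun k _ => ?_
  rw [Finset.sum_product, Matrix.sum_mulVec, Finset.sum_apply]
  refine Finset.sum_congr rfl fun l _ => ?_
  rw [Matrix.smul_mulVec, Pi.smul_apply, Matrix.mulVec, dotProduct, Finset.smul_sum]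
  refine Finset.sum_congr rfl fun j _ => ?_
  rw [smul_eq_mul]
  ring

theorem A_nonneg_of_mem {q : ℤ × ℤ × S} (hq : q ∈ stepIndex S) (i : S) :
    0 ≤ M.A q.1 q.2.1 i q.2.2 := by
  rw [stepIndex, Finset.mem_product, Finset.mem_product] at hq
  exact M.A_nonneg _ hq.1 _ hq.2.1 _ _

theorem C_nonneg {z w : ℝ} (hz : 0 ≤ z) (hw : 0 ≤ w) (i j : S) : 0 ≤ M.C z w i j := by
  rw [C, Matrix.sum_apply]
  refine Finset.sum_nonneg fun k hk => ?_
  rw [Matrix.sum_apply]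
  refine Finset.sum_nonneg fun l hl => ?_
  rw [Matrix.smul_apply]
  exact mul_nonneg (mul_nonneg (zpow_nonneg hz _) (zpow_nonneg hw _)) (M.A_nonneg k hk l hl i j)

theorem C_one_one_mulVec (i : S) : (M.C 1 1 *ᵥ fun _ => 1) i = 1 := by
  have : M.C 1 1 = ∑ k ∈ incH, ∑ l ∈ incH, M.A k l := by simp [C]
  simp [this, Matrix.mulVec, dotProduct, M.A_stoch i]

/-- `h` is a strictly positive vector with `C(z,w) h ≤ h`. -/
def IsSubinvariant (z w : ℝ) (h : S → ℝ) : Prop :=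
  (∀ i, 0 < h i) ∧ ∀ i, (M.C z w *ᵥ h) i ≤ h i

/-- `h` is a strictly positive vector with `C(z,w) h < h` in every entry. -/
def IsStrictSubinvariant (z w : ℝ) (h : S → ℝ) : Prop :=
  (∀ i, 0 < h i) ∧ ∀ i, (M.C z w *ᵥ h) i < h i

/-- The points of the open quadrant at which `C(z,w)` has a positive subinvariant vector. -/
def subinvRegion : Set (ℝ × ℝ) := {q | 0 < q.1 ∧ 0 < q.2 ∧ ∃ h, M.IsSubinvariant q.1 q.2 h}

variable {M}

theorem IsStrictSubinvariant.isSubinvariant {z w : ℝ} {h : S → ℝ}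
    (hh : M.IsStrictSubinvariant z w h) : M.IsSubinvariant z w h :=
  ⟨hh.1, fun i => (hh.2 i).le⟩

theorem isSubinvariant_one : M.IsSubinvariant 1 1 fun _ => 1 :=
  ⟨fun _ => one_pos, fun i => (M.C_one_one_mulVec i).le⟩

theorem PFree_mul_le {z w : ℝ} {h : S → ℝ} (hz : 0 < z) (hw : 0 < w) (hh : ∀ i, 0 ≤ h i)
    (hC : ∀ i, (M.C z w *ᵥ h) i ≤ h i) (x y : ℤ × ℤ × S) :
    M.PFree x y * (z ^ y.1 * w ^ y.2.1 * h y.2.2) ≤ z ^ x.1 * w ^ x.2.1 * h x.2.2 := by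
  have hx : 0 < z ^ x.1 * w ^ x.2.1 := mul_pos (zpow_pos hz _) (zpow_pos hw _)
  unfold PFree
  simp only
  split_ifs with hd
  · have hmem : ((y.1 - x.1, y.2.1 - x.2.1, y.2.2) : ℤ × ℤ × S) ∈ stepIndex S := by
      simp [stepIndex, hd]
    have h1 : M.A (y.1 - x.1) (y.2.1 - x.2.1) x.2.2 y.2.2 *
        (z ^ (y.1 - x.1) * w ^ (y.2.1 - x.2.1) * h y.2.2) ≤ h x.2.2 := by
      refine le_trans ?_ (hC x.2.2)
      rw [C_mulVec_apply]
      exact Finset.single_le_sum (f := fun q : ℤ × ℤ × S =>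
        M.A q.1 q.2.1 x.2.2 q.2.2 * (z ^ q.1 * w ^ q.2.1 * h q.2.2))
        (fun q hq => mul_nonneg (M.A_nonneg_of_mem hq _)
          (mul_nonneg (mul_nonneg (zpow_nonneg hz.le _) (zpow_nonneg hw.le _)) (hh _))) hmem
    refine le_trans (le_of_eq ?_) (mul_le_mul_of_nonneg_left h1 hx.le)
    rw [zpow_sub₀ hz.ne', zpow_sub₀ hw.ne']
    have := (zpow_pos hz x.1).ne'
    have := (zpow_pos hw x.2.1).ne'
    field_simp
  · rw [zero_mul]
    exact mul_nonneg hx.le (hh _)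

theorem pos_of_subinvariant (hFree : ChainIrreducible M.PFree) {z w : ℝ} {h : S → ℝ}
    (hz : 0 < z) (hw : 0 < w) (hh : ∀ i, 0 ≤ h i) (hC : ∀ i, (M.C z w *ᵥ h) i ≤ h i) {j : S}
    (hj : 0 < h j) (i : S) : 0 < h i := by
  obtain ⟨n, hn⟩ := hFree (0, 0, i) (0, 0, j)
  obtain ⟨c, hc, H⟩ := hn.exists_pos_mul_le
  have := H (fun x => z ^ x.1 * w ^ x.2.1 * h x.2.2) (PFree_mul_le hz hw hh hC)
  simp only [zpow_zero, one_mul] at this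
  exact lt_of_lt_of_le (mul_pos hc hj) this

theorem subinvRegion_bounds [Nonempty S] (hFree : ChainIrreducible M.PFree) :
    ∃ a b : ℝ, 0 < a ∧ M.subinvRegion ⊆ Set.Icc a b ×ˢ Set.Icc a b := by
  obtain ⟨j⟩ := ‹Nonempty S›
  obtain ⟨n1, h1⟩ := hFree (0, 0, j) (1, 0, j)
  obtain ⟨n2, h2⟩ := hFree (0, 0, j) (-1, 0, j)
  obtain ⟨n3, h3⟩ := hFree (0, 0, j) (0, 1, j)
  obtain ⟨n4, h4⟩ := hFree (0, 0, j) (0, -1, j)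
  obtain ⟨c1, hc1, H1⟩ := h1.exists_pos_mul_le
  obtain ⟨c2, hc2, H2⟩ := h2.exists_pos_mul_le
  obtain ⟨c3, hc3, H3⟩ := h3.exists_pos_mul_le
  obtain ⟨c4, hc4, H4⟩ := h4.exists_pos_mul_le
  refine ⟨min c2 c4, max c1⁻¹ c3⁻¹, lt_min hc2 hc4, ?_⟩
  rintro ⟨z, w⟩ ⟨hz, hw, h, hh, hC⟩
  simp only at hz hw hC
  have hV := PFree_mul_le hz hw (fun i => (hh i).le) hC
  have e1 := H1 (fun x => z ^ x.1 * w ^ x.2.1 * h x.2.2) hV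
  have e2 := H2 (fun x => z ^ x.1 * w ^ x.2.1 * h x.2.2) hV
  have e3 := H3 (fun x => z ^ x.1 * w ^ x.2.1 * h x.2.2) hV
  have e4 := H4 (fun x => z ^ x.1 * w ^ x.2.1 * h x.2.2) hV
  simp only [zpow_zero, one_mul, zpow_one, mul_one, zpow_neg] at e1 e2 e3 e4
  have aux : ∀ {c q : ℝ}, 0 < c → c * (q * h j) ≤ h j → q ≤ c⁻¹ := by
    intro c q hc e
    have : c * q ≤ 1 := le_of_mul_le_mul_right (by linarith) (hh j)
    rw [← one_div, le_div_iff₀ hc]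
    linarith
  refine ⟨⟨?_, ?_⟩, ⟨?_, ?_⟩⟩
  · exact (min_le_left _ _).trans ((inv_le_inv₀ hz hc2).1 (aux hc2 e2))
  · exact (aux hc1 e1).trans (le_max_left _ _)
  · exact (min_le_right _ _).trans ((inv_le_inv₀ hw hc4).1 (aux hc4 e4))
  · exact (aux hc3 e3).trans (le_max_right _ _)

theorem continuousAt_C_mulVec {z w : ℝ} (hz : z ≠ 0) (hw : w ≠ 0) (g : S → ℝ) (i : S) :
    ContinuousAt (fun q : (ℝ × ℝ) × (S → ℝ) => (M.C q.1.1 q.1.2 *ᵥ q.2) i) ((z, w), g) := by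
  simp only [C_mulVec_apply]
  refine tendsto_finsetSum _ fun q _ => ?_
  have h1 : ContinuousAt (fun r : (ℝ × ℝ) × (S → ℝ) => r.1.1 ^ q.1) ((z, w), g) :=
    ContinuousAt.zpow₀ (by fun_prop) _ (Or.inl hz)
  have h2 : ContinuousAt (fun r : (ℝ × ℝ) × (S → ℝ) => r.1.2 ^ q.2.1) ((z, w), g) :=
    ContinuousAt.zpow₀ (by fun_prop) _ (Or.inl hw)
  have h3 : ContinuousAt (fun r : (ℝ × ℝ) × (S → ℝ) => r.2 q.2.2) ((z, w), g) := by fun_prop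
  exact ((h1.mul h2).mul h3).const_mul _

/-- Limits of points with almost subinvariant positive vectors have subinvariant vectors. -/
theorem exists_isSubinvariant_of_tendsto [Nonempty S] (hFree : ChainIrreducible M.PFree)
    {u : ℕ → ℝ × ℝ} {c : ℕ → ℝ} {h : ℕ → S → ℝ} {z w : ℝ} (hz : 0 < z) (hw : 0 < w)
    (hu : Tendsto u atTop (𝓝 (z, w))) (hc : Tendsto c atTop (𝓝 1)) (hh : ∀ n i, 0 < h n i)
    (hle : ∀ n i, (M.C (u n).1 (u n).2 *ᵥ h n) i ≤ c n * h n i) :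
    ∃ g, M.IsSubinvariant z w g := by
  have hs : ∀ n, 0 < ∑ i, h n i := fun n => Finset.sum_pos (fun i _ => hh n i) Finset.univ_nonempty
  have hmem : ∀ n, (∑ i, h n i)⁻¹ • h n ∈ stdSimplex ℝ S := by
    intro n
    refine ⟨fun i => mul_nonneg (inv_nonneg.2 (hs n).le) (hh n i).le, ?_⟩
    simp only [Pi.smul_apply, smul_eq_mul, ← Finset.mul_sum]
    exact inv_mul_cancel₀ (hs n).ne'
  obtain ⟨g, hg, φ, hφ, hlim⟩ := (isCompact_stdSimplex ℝ S).tendsto_subseq hmem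
  have hC : ∀ i, (M.C z w *ᵥ g) i ≤ g i := by
    intro i
    have h1 : Tendsto (fun n => ((u (φ n), (∑ i, h (φ n) i)⁻¹ • h (φ n)) : (ℝ × ℝ) × (S → ℝ)))
        atTop (𝓝 ((z, w), g)) :=
      (hu.comp hφ.tendsto_atTop).prodMk_nhds hlim
    have h2 := (continuousAt_C_mulVec (M := M) hz.ne' hw.ne' g i).tendsto.comp h1
    have h3 := (hc.comp hφ.tendsto_atTop).mul ((tendsto_pi_nhds.1 hlim) i)
    rw [one_mul] at h3
    refine le_of_tendsto_of_tendsto' h2 h3 fun n => ?_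
    simp only [Function.comp_apply, Matrix.mulVec_smul, Pi.smul_apply, smul_eq_mul]
    have := mul_le_mul_of_nonneg_left (hle (φ n) i) (inv_nonneg.2 (hs (φ n)).le)
    linarith
  obtain ⟨j, -, hj⟩ : ∃ j ∈ Finset.univ, 0 < g j := by
    by_contra! hcon
    have := Finset.sum_nonpos hcon
    linarith [hg.2]
  exact ⟨g, pos_of_subinvariant hFree hz hw hg.1 hC hj, hC⟩

theorem isCompact_subinvRegion [Nonempty S] (hFree : ChainIrreducible M.PFree) :
    IsCompact M.subinvRegion := by
  obtain ⟨a, b, ha, hab⟩ := subinvRegion_bounds hFree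
  refine (isCompact_Icc.prod isCompact_Icc).of_isClosed_subset ?_ hab
  refine IsSeqClosed.isClosed fun u q hu hq => ?_
  have hq' : q ∈ Set.Icc a b ×ˢ Set.Icc a b :=
    (isClosed_Icc.prod isClosed_Icc).mem_of_tendsto hq (Eventually.of_forall fun n => hab (hu n))
  choose hu1 hu2 h hh using hu
  have hz := ha.trans_le hq'.1.1
  have hw := ha.trans_le hq'.2.1
  exact ⟨hz, hw, exists_isSubinvariant_of_tendsto hFree hz hw hq tendsto_const_nhds
    (fun n => (hh n).1) (c := fun _ => 1) (fun n i => by rw [one_mul]; exact (hh n).2 i)⟩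

/-- Logarithmic convexity of the region of subinvariance. -/
theorem IsSubinvariant.rpow_mul_rpow {z₀ w₀ z₁ w₁ t : ℝ} {h₀ h₁ : S → ℝ} (hz₀ : 0 < z₀)
    (hw₀ : 0 < w₀) (hz₁ : 0 < z₁) (hw₁ : 0 < w₁) (hh₀ : M.IsSubinvariant z₀ w₀ h₀)
    (hh₁ : M.IsStrictSubinvariant z₁ w₁ h₁) (ht : 0 < t) (ht1 : t ≤ 1) :
    M.IsStrictSubinvariant (z₀ ^ (1 - t) * z₁ ^ t) (w₀ ^ (1 - t) * w₁ ^ t)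
      (fun i => h₀ i ^ (1 - t) * h₁ i ^ t) := by
  have hpos : ∀ i, 0 < h₀ i ^ (1 - t) * h₁ i ^ t := fun i =>
    mul_pos (Real.rpow_pos_of_pos (hh₀.1 i) _) (Real.rpow_pos_of_pos (hh₁.1 i) _)
  refine ⟨hpos, fun i => ?_⟩
  have e0 := hh₀.2 i
  have e1 := hh₁.2 i
  rw [C_mulVec_apply] at e0 e1 ⊢
  have hterm : ∀ q ∈ stepIndex S, M.A q.1 q.2.1 i q.2.2 *
      ((z₀ ^ (1 - t) * z₁ ^ t) ^ q.1 * (w₀ ^ (1 - t) * w₁ ^ t) ^ q.2.1 *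
        (h₀ q.2.2 ^ (1 - t) * h₁ q.2.2 ^ t)) ≤
      (h₀ i ^ (1 - t) * h₁ i ^ t) * ((1 - t) / h₀ i *
        (M.A q.1 q.2.1 i q.2.2 * (z₀ ^ q.1 * w₀ ^ q.2.1 * h₀ q.2.2)) + t / h₁ i *
        (M.A q.1 q.2.1 i q.2.2 * (z₁ ^ q.1 * w₁ ^ q.2.1 * h₁ q.2.2))) := by
    intro q hq
    set X₀ := z₀ ^ q.1 * w₀ ^ q.2.1 * h₀ q.2.2 with hX₀
    set X₁ := z₁ ^ q.1 * w₁ ^ q.2.1 * h₁ q.2.2 with hX₁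
    have hX₀p : 0 < X₀ := mul_pos (mul_pos (zpow_pos hz₀ _) (zpow_pos hw₀ _)) (hh₀.1 _)
    have hX₁p : 0 < X₁ := mul_pos (mul_pos (zpow_pos hz₁ _) (zpow_pos hw₁ _)) (hh₁.1 _)
    have hX : (z₀ ^ (1 - t) * z₁ ^ t) ^ q.1 * (w₀ ^ (1 - t) * w₁ ^ t) ^ q.2.1 *
        (h₀ q.2.2 ^ (1 - t) * h₁ q.2.2 ^ t) = X₀ ^ (1 - t) * X₁ ^ t := by
      have aux : ∀ {r s : ℝ} (k : ℤ), 0 < r → (r ^ s) ^ k = (r ^ k) ^ s := fun {r s} k hr => by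
        rw [← Real.rpow_intCast, ← Real.rpow_intCast, ← Real.rpow_mul hr.le,
          ← Real.rpow_mul hr.le, mul_comm]
      rw [hX₀, hX₁, mul_zpow, mul_zpow, aux _ hz₀, aux _ hz₁, aux _ hw₀, aux _ hw₁,
        Real.mul_rpow (mul_pos (zpow_pos hz₀ _) (zpow_pos hw₀ _)).le (hh₀.1 _).le,
        Real.mul_rpow (zpow_pos hz₀ _).le (zpow_pos hw₀ _).le,
        Real.mul_rpow (mul_pos (zpow_pos hz₁ _) (zpow_pos hw₁ _)).le (hh₁.1 _).le,
        Real.mul_rpow (zpow_pos hz₁ _).le (zpow_pos hw₁ _).le]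
      ring
    have hyoung : X₀ ^ (1 - t) * X₁ ^ t ≤
        (h₀ i ^ (1 - t) * h₁ i ^ t) * ((1 - t) / h₀ i * X₀ + t / h₁ i * X₁) := by
      have h1 := Real.geom_mean_le_arith_mean2_weighted (sub_nonneg.2 ht1) ht.le
        (div_pos hX₀p (hh₀.1 i)).le (div_pos hX₁p (hh₁.1 i)).le (by ring)
      rw [Real.div_rpow hX₀p.le (hh₀.1 i).le, Real.div_rpow hX₁p.le (hh₁.1 i).le,
        div_mul_div_comm, div_le_iff₀ (hpos i)] at h1
      calc _ ≤ _ := h1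
        _ = _ := by ring
    rw [hX]
    calc _ ≤ M.A q.1 q.2.1 i q.2.2 * ((h₀ i ^ (1 - t) * h₁ i ^ t) *
          ((1 - t) / h₀ i * X₀ + t / h₁ i * X₁)) :=
          mul_le_mul_of_nonneg_left hyoung (M.A_nonneg_of_mem hq i)
      _ = _ := by ring
  refine (Finset.sum_le_sum hterm).trans_lt ?_
  rw [← Finset.mul_sum, Finset.sum_add_distrib, ← Finset.mul_sum, ← Finset.mul_sum]
  refine mul_lt_of_lt_one_right (hpos i) ?_
  have b0 : (1 - t) / h₀ i * ∑ q ∈ stepIndex S, M.A q.1 q.2.1 i q.2.2 *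
      (z₀ ^ q.1 * w₀ ^ q.2.1 * h₀ q.2.2) ≤ 1 - t := by
    refine (mul_le_mul_of_nonneg_left e0 (div_nonneg (sub_nonneg.2 ht1) (hh₀.1 i).le)).trans ?_
    rw [div_mul_cancel₀ _ (hh₀.1 i).ne']
  have b1 : t / h₁ i * ∑ q ∈ stepIndex S, M.A q.1 q.2.1 i q.2.2 *
      (z₁ ^ q.1 * w₁ ^ q.2.1 * h₁ q.2.2) < t := by
    refine (mul_lt_mul_of_pos_left e1 (div_pos ht (hh₁.1 i))).trans_le ?_
    rw [div_mul_cancel₀ _ (hh₁.1 i).ne']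
  linarith

theorem IsStrictSubinvariant.eventually {z w : ℝ} {h : S → ℝ} (hz : z ≠ 0) (hw : w ≠ 0)
    (hh : M.IsStrictSubinvariant z w h) :
    ∀ᶠ q : ℝ × ℝ in 𝓝 (z, w), M.IsStrictSubinvariant q.1 q.2 h := by
  have : ∀ᶠ q : ℝ × ℝ in 𝓝 (z, w), ∀ i, (M.C q.1 q.2 *ᵥ h) i < h i := by
    refine eventually_all.2 fun i => ?_
    have h1 : ContinuousAt (fun q : ℝ × ℝ => (M.C q.1 q.2 *ᵥ h) i) (z, w) :=
      (continuousAt_C_mulVec hz hw h i).comp (f := fun q : ℝ × ℝ => (q, h)) (by fun_prop)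
    exact h1.eventually_lt_const (hh.2 i)
  exact this.mono fun q hq => ⟨hh.1, hq⟩

variable [DecidableEq S] [Nonempty S]

theorem exists_isStrictSubinvariant {z w : ℝ} (hz : 0 < z) (hw : 0 < w)
    (h : spr (M.C z w) < 1) : ∃ g, M.IsStrictSubinvariant z w g := by
  obtain ⟨g, hg, hlt⟩ := exists_mulVec_lt_of_spr_lt (M.C_nonneg hz.le hw.le) h
  exact ⟨g, hg, fun i => by simpa using hlt i⟩

omit [Nonempty S] in
theorem IsSubinvariant.chi_le_one {z w : ℝ} {h : S → ℝ} (hz : 0 < z) (hw : 0 < w)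
    (hh : M.IsSubinvariant z w h) : M.chi z w ≤ 1 :=
  spr_le_of_mulVec_le (M.C_nonneg hz.le hw.le) hh.1 zero_le_one
    fun i => by rw [one_mul]; exact hh.2 i

omit [Nonempty S] in
theorem IsStrictSubinvariant.chi_lt_one {z w : ℝ} {h : S → ℝ} (hz : 0 < z) (hw : 0 < w)
    (hh : M.IsStrictSubinvariant z w h) : M.chi z w < 1 :=
  spr_lt_one_of_mulVec_lt (M.C_nonneg hz.le hw.le) hh.1 hh.2

theorem mem_subinvRegion_iff (hFree : ChainIrreducible M.PFree) {z w : ℝ} (hz : 0 < z)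
    (hw : 0 < w) : (z, w) ∈ M.subinvRegion ↔ M.chi z w ≤ 1 := by
  refine ⟨fun ⟨_, _, h, hh⟩ => hh.chi_le_one hz hw, fun hchi => ⟨hz, hw, ?_⟩⟩
  have hlt : ∀ n : ℕ, spr (M.C z w) < 1 + 1 / ((n : ℝ) + 1) := fun n =>
    lt_of_le_of_lt hchi (lt_add_of_pos_right _ (by positivity))
  choose h hh hle using fun n => exists_mulVec_lt_of_spr_lt (M.C_nonneg hz.le hw.le) (hlt n)
  refine exists_isSubinvariant_of_tendsto (u := fun _ => (z, w)) hFree hz hw tendsto_const_nhds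
    ?_ hh fun n i => (hle n i).le
  simpa using tendsto_one_div_add_atTop_nhds_zero_nat.const_add (1 : ℝ)

theorem exists_mem_subinvRegion_zLow1 (hFree : ChainIrreducible M.PFree) :
    ∃ w, (M.zLow1, w) ∈ M.subinvRegion := by
  have hne : M.subinvRegion.Nonempty := ⟨(1, 1), one_pos, one_pos, _, isSubinvariant_one⟩
  obtain ⟨q, hq, hmin⟩ := (isCompact_subinvRegion hFree).exists_isMinOn hne continuousOn_fst
  have hleast : IsLeast (Prod.fst '' M.Gam) (Real.log q.1) := by
    constructor
    · refine ⟨(Real.log q.1, Real.log q.2), ?_, rfl⟩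
      change M.chi (Real.exp (Real.log q.1)) (Real.exp (Real.log q.2)) ≤ 1
      rw [Real.exp_log hq.1, Real.exp_log hq.2.1]
      exact (mem_subinvRegion_iff hFree hq.1 hq.2.1).1 hq
    · rintro _ ⟨s, hs, rfl⟩
      have h1 := hmin ((mem_subinvRegion_iff hFree (Real.exp_pos s.1) (Real.exp_pos s.2)).2 hs)
      exact (Real.log_le_iff_le_exp hq.1).2 h1
  refine ⟨q.2, ?_⟩
  rw [zLow1, hleast.csInf_eq, Real.exp_log hq.1]
  exact hq

theorem isLeast_zetaLow2 (hFree : ChainIrreducible M.PFree) {z : ℝ} (hz : 0 < z)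
    (hne : ∃ w, (z, w) ∈ M.subinvRegion) :
    IsLeast {w | (z, w) ∈ M.subinvRegion} (M.zetaLow2 z) ∧ M.chi z (M.zetaLow2 z) = 1 := by
  have hcomp : IsCompact {w | (z, w) ∈ M.subinvRegion} := by
    have h1 : {w | (z, w) ∈ M.subinvRegion} = Prod.snd '' (M.subinvRegion ∩ Prod.fst ⁻¹' {z}) := by
      ext w
      constructor
      · exact fun hw => ⟨(z, w), ⟨hw, rfl⟩, rfl⟩
      · rintro ⟨⟨z', w'⟩, ⟨h1, rfl⟩, rfl⟩
        exact h1
    rw [h1]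
    exact ((isCompact_subinvRegion hFree).inter_right
      (isClosed_singleton.preimage continuous_fst)).image continuous_snd
  obtain ⟨w₀, hw₀⟩ := hcomp.exists_isLeast hne
  have hw₀p : 0 < w₀ := hw₀.1.2.1
  have hchi : M.chi z w₀ = 1 := by
    refine le_antisymm ((mem_subinvRegion_iff hFree hz hw₀p).1 hw₀.1) (not_lt.1 fun hlt => ?_)
    obtain ⟨g, hg⟩ := exists_isStrictSubinvariant hz hw₀p hlt
    have hcont : Tendsto (fun w : ℝ => (z, w)) (𝓝 w₀) (𝓝 (z, w₀)) := by
      exact (Continuous.prodMk_right z).tendsto w₀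
    have hev : ∀ᶠ w in 𝓝 w₀, M.IsStrictSubinvariant z w g :=
      hcont.eventually (hg.eventually hz.ne' hw₀p.ne')
    obtain ⟨w, ⟨hw1, hw2⟩, hw3⟩ := ((hev.and (lt_mem_nhds hw₀p)).filter_mono
      nhdsWithin_le_nhds |>.and (self_mem_nhdsWithin (s := Set.Iio w₀))).exists
    exact (hw₀.2 ⟨hz, hw2, g, hw1.isSubinvariant⟩).not_gt hw3
  have hzeta : M.zetaLow2 z = w₀ := by
    refine IsLeast.csInf_eq ⟨⟨hw₀p, hchi⟩, fun w hw => hw₀.2 ?_⟩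
    exact (mem_subinvRegion_iff hFree hz hw.1).2 hw.2.le
  rw [hzeta]
  exact ⟨hw₀, hchi⟩

/-- The lower branch of the curve `χ = 1` is attained on the left of strictly subcritical points
of the quadrant. -/
theorem isLeast_zetaLow2_of_zLow1_le (hFree : ChainIrreducible M.PFree) {z z' w' : ℝ}
    (hz : M.zLow1 ≤ z) (hzz : z < z') (hw' : 0 < w') (hlt : M.chi z' w' < 1) :
    IsLeast {w | (z, w) ∈ M.subinvRegion} (M.zetaLow2 z) ∧ M.chi z (M.zetaLow2 z) = 1 := by
  have hlow : 0 < M.zLow1 := Real.exp_pos _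
  have hz0 : 0 < z := hlow.trans_le hz
  refine isLeast_zetaLow2 hFree hz0 ?_
  obtain ⟨w, hw⟩ := exists_mem_subinvRegion_zLow1 hFree
  rcases hz.eq_or_lt with rfl | hlt'
  · exact ⟨w, hw⟩
  · obtain ⟨t, ht, ht1, rfl⟩ := exists_rpow_mul_rpow_eq hlow hlt' hzz.le
    obtain ⟨g, hg⟩ := exists_isStrictSubinvariant (hz0.trans hzz) hw' hlt
    obtain ⟨-, hw0, h, hh⟩ := hw
    exact ⟨_, hz0, mul_pos (Real.rpow_pos_of_pos hw0 _) (Real.rpow_pos_of_pos hw' _), _,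
      (hh.rpow_mul_rpow hlow hw0 (by linarith) hw' hg ht ht1).isSubinvariant⟩

/-- Between `1` and the abscissa of a strictly subcritical point there are strictly subcritical
points above the lower branch. -/
theorem exists_isStrictSubinvariant_of_one_lt {z z' w' : ℝ}
    (hz : 1 < z) (hzz : z < z') (hw' : 0 < w') (hlt : M.chi z' w' < 1)
    (hleast : IsLeast {w | (z, w) ∈ M.subinvRegion} (M.zetaLow2 z))
    (hchi : M.chi z (M.zetaLow2 z) = 1) :
    ∃ w h, M.zetaLow2 z < w ∧ M.IsStrictSubinvariant z w h := by
  obtain ⟨t, ht, ht1, hzt⟩ := exists_rpow_mul_rpow_eq one_pos hz hzz.le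
  have hz0 : 0 < z := one_pos.trans hz
  obtain ⟨g, hg⟩ := exists_isStrictSubinvariant (hz0.trans hzz) hw' hlt
  have h1 := isSubinvariant_one.rpow_mul_rpow one_pos one_pos (hz0.trans hzz) hw' hg ht ht1
  rw [hzt] at h1
  have hw : 0 < (1 : ℝ) ^ (1 - t) * w' ^ t :=
    mul_pos (Real.rpow_pos_of_pos one_pos _) (Real.rpow_pos_of_pos hw' _)
  refine ⟨_, _, lt_of_le_of_ne (hleast.2 ⟨hz0, hw, _, h1.isSubinvariant⟩) fun he => ?_, h1⟩
  have := h1.chi_lt_one hz0 hw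
  rw [← he] at this
  linarith

end QBD2

/-! ### Entrywise order on matrices -/

namespace Matrix

variable {S : Type*} [Fintype S]

theorem mul_apply_le_mul_apply {A B X Y : Matrix S S ℝ} (hA : ∀ i j, 0 ≤ A i j)
    (hAB : ∀ i j, A i j ≤ B i j) (hX : ∀ i j, 0 ≤ X i j) (hXY : ∀ i j, X i j ≤ Y i j) (i j : S) :
    (A * X) i j ≤ (B * Y) i j := by
  rw [Matrix.mul_apply, Matrix.mul_apply]
  exact Finset.sum_le_sum fun k _ =>
    mul_le_mul (hAB i k) (hXY k j) (hX k j) ((hA i k).trans (hAB i k))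

theorem mul_apply_nonneg {A X : Matrix S S ℝ} (hA : ∀ i j, 0 ≤ A i j) (hX : ∀ i j, 0 ≤ X i j)
    (i j : S) : 0 ≤ (A * X) i j := by
  rw [Matrix.mul_apply]
  exact Finset.sum_nonneg fun k _ => mul_nonneg (hA i k) (hX k j)

theorem mulVec_apply_mono {A : Matrix S S ℝ} (hA : ∀ i j, 0 ≤ A i j) {u v : S → ℝ}
    (huv : ∀ i, u i ≤ v i) (i : S) : (A *ᵥ u) i ≤ (A *ᵥ v) i :=
  Finset.sum_le_sum fun j _ => mul_le_mul_of_nonneg_left (huv j) (hA i j)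

theorem mulVec_apply_nonneg {A : Matrix S S ℝ} (hA : ∀ i j, 0 ≤ A i j) {u : S → ℝ}
    (hu : ∀ i, 0 ≤ u i) (i : S) : 0 ≤ (A *ᵥ u) i :=
  Finset.sum_nonneg fun j _ => mul_nonneg (hA i j) (hu j)

theorem apply_le_div_of_mulVec_le {A : Matrix S S ℝ} (hA : ∀ i j, 0 ≤ A i j) {h : S → ℝ}
    (hh : ∀ i, 0 < h i) {c : ℝ} (hle : ∀ i, (A *ᵥ h) i ≤ c * h i) (i j : S) :
    A i j ≤ c * h i / h j := by
  rw [le_div_iff₀ (hh j)]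
  exact (Finset.single_le_sum (f := fun j => A i j * h j)
    (fun j _ => mul_nonneg (hA i j) (hh j).le) (Finset.mem_univ j)).trans (hle i)

theorem pow_mulVec_le [DecidableEq S] {A : Matrix S S ℝ} (hA : ∀ i j, 0 ≤ A i j) {h : S → ℝ}
    {c : ℝ} (hc : 0 ≤ c) (hle : ∀ i, (A *ᵥ h) i ≤ c * h i) (n : ℕ) (i : S) :
    ((A ^ n) *ᵥ h) i ≤ c ^ n * h i := by
  induction n generalizing i with
  | zero => simp
  | succ n ih =>
    rw [pow_succ', ← Matrix.mulVec_mulVec]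
    refine (mulVec_apply_mono hA (v := c ^ n • h) ih i).trans ?_
    rw [Matrix.mulVec_smul, Pi.smul_apply, smul_eq_mul, pow_succ, mul_assoc]
    exact mul_le_mul_of_nonneg_left (hle i) (pow_nonneg hc n)

end Matrix

namespace QBD2

variable {S : Type*} [Fintype S] {M : QBD2 S}

/-! ### Generating functions of the blocks -/

theorem colA_nonneg {l : ℤ} (hl : l ∈ incH) {z : ℝ} (hz : 0 ≤ z) (i j : S) :
    0 ≤ M.colA l z i j := by
  rw [colA, Matrix.sum_apply]
  exact Finset.sum_nonneg fun k hk => mul_nonneg (zpow_nonneg hz k) (M.A_nonneg k hk l hl i j)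

theorem colA1_nonneg {l : ℤ} (hl : l ∈ incHp) {z : ℝ} (hz : 0 ≤ z) (i j : S) :
    0 ≤ M.colA1 l z i j := by
  rw [colA1, Matrix.sum_apply]
  exact Finset.sum_nonneg fun k hk => mul_nonneg (zpow_nonneg hz k) (M.A1_nonneg k hk l hl i j)

theorem C_eq_colA (z w : ℝ) :
    M.C z w = w⁻¹ • M.colA (-1) z + M.colA 0 z + w • M.colA 1 z := by
  simp only [C, colA, incH]
  ext i j
  simp [Finset.sum_insert, Matrix.add_apply, Matrix.smul_apply]
  ring

theorem colA_mulVec_le {z w : ℝ} (hw : 0 < w) {h : S → ℝ} (hh : M.IsSubinvariant z w h) (i : S) :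
    (M.colA (-1) z *ᵥ h) i + w * (M.colA 0 z *ᵥ h) i + w ^ 2 * (M.colA 1 z *ᵥ h) i ≤ w * h i := by
  have h1 := mul_le_mul_of_nonneg_left (hh.2 i) hw.le
  rw [C_eq_colA, Matrix.add_mulVec, Matrix.add_mulVec, Matrix.smul_mulVec,
    Matrix.smul_mulVec] at h1
  simp only [Pi.add_apply, Pi.smul_apply, smul_eq_mul] at h1
  refine le_trans (le_of_eq ?_) h1
  field_simp

/-! ### The minimal nonnegative solution -/

/-- The map whose fixed points are the solutions of the quadratic matrix equation. -/
noncomputable def solStep (M : QBD2 S) [DecidableEq S] (z : ℝ) (X : Matrix S S ℝ) : Matrix S S ℝ :=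
  M.colA (-1) z + M.colA 0 z * X + M.colA 1 z * X ^ 2

variable [DecidableEq S]

theorem solStep_nonneg {z : ℝ} (hz : 0 ≤ z) {X : Matrix S S ℝ} (hX : ∀ i j, 0 ≤ X i j) (i j : S) :
    0 ≤ M.solStep z X i j :=
  add_nonneg (add_nonneg (colA_nonneg (by decide) hz i j)
    (Matrix.mul_apply_nonneg (colA_nonneg (by decide) hz) hX i j))
    (Matrix.mul_apply_nonneg (colA_nonneg (by decide) hz) (Matrix.pow_apply_nonneg hX 2) i j)

theorem solStep_mono {z : ℝ} (hz : 0 ≤ z) {X Y : Matrix S S ℝ} (hX : ∀ i j, 0 ≤ X i j)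
    (hXY : ∀ i j, X i j ≤ Y i j) (i j : S) : M.solStep z X i j ≤ M.solStep z Y i j := by
  have hsq : ∀ i j, (X ^ 2) i j ≤ (Y ^ 2) i j := by
    rw [pow_two, pow_two]
    exact Matrix.mul_apply_le_mul_apply hX hXY hX hXY
  exact add_le_add (add_le_add le_rfl (Matrix.mul_apply_le_mul_apply (colA_nonneg (by decide) hz)
    (fun _ _ => le_rfl) hX hXY i j)) (Matrix.mul_apply_le_mul_apply (colA_nonneg (by decide) hz)
    (fun _ _ => le_rfl) (Matrix.pow_apply_nonneg hX 2) hsq i j)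

theorem solStep_mulVec_le {z w : ℝ} (hz : 0 ≤ z) (hw : 0 < w) {h : S → ℝ}
    (hh : M.IsSubinvariant z w h) {X : Matrix S S ℝ} (hX : ∀ i j, 0 ≤ X i j)
    (hle : ∀ i, (X *ᵥ h) i ≤ w * h i) (i : S) : (M.solStep z X *ᵥ h) i ≤ w * h i := by
  refine le_trans ?_ (colA_mulVec_le hw hh i)
  rw [solStep, Matrix.add_mulVec, Matrix.add_mulVec, ← Matrix.mulVec_mulVec,
    ← Matrix.mulVec_mulVec]
  have e0 := Matrix.mulVec_apply_mono (colA_nonneg (M := M) (l := 0) (by decide) hz)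
    (v := w • h) hle i
  have e1 := Matrix.mulVec_apply_mono (colA_nonneg (M := M) (l := 1) (by decide) hz)
    (v := w ^ 2 • h) (Matrix.pow_mulVec_le hX hw.le hle 2) i
  rw [Matrix.mulVec_smul, Pi.smul_apply, smul_eq_mul] at e0 e1
  exact add_le_add (add_le_add le_rfl e0) e1

theorem exists_isG1 {z w : ℝ} (hz : 0 ≤ z) (hw : 0 < w) {h : S → ℝ}
    (hh : M.IsSubinvariant z w h) :
    ∃ G, M.IsG1 z G ∧ ∀ i, (G *ᵥ h) i ≤ w * h i := by
  set X : ℕ → Matrix S S ℝ := fun n => (M.solStep z)^[n] 0 with hX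
  have hsucc : ∀ n, X (n + 1) = M.solStep z (X n) := fun n =>
    Function.iterate_succ_apply' _ _ _
  have hnn : ∀ n i j, 0 ≤ X n i j := by
    intro n
    induction n with
    | zero => exact fun i j => le_rfl
    | succ n ih => rw [hsucc]; exact solStep_nonneg hz ih
  have hmono : ∀ i j, Monotone fun n => X n i j := by
    intro i j
    refine monotone_nat_of_le_succ fun n => ?_
    induction n generalizing i j with
    | zero => exact hnn 1 i j
    | succ n ih => rw [hsucc, hsucc (n + 1)]; exact solStep_mono hz (hnn n) ih i j
  have hXh : ∀ n i, (X n *ᵥ h) i ≤ w * h i := by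
    intro n
    induction n with
    | zero =>
      intro i
      simp only [hX, Function.iterate_zero, id_eq, Matrix.zero_mulVec, Pi.zero_apply]
      exact (mul_pos hw (hh.1 i)).le
    | succ n ih => rw [hsucc]; exact solStep_mulVec_le hz hw hh (hnn n) ih
  have hbdd : ∀ i j, BddAbove (Set.range fun n => X n i j) := fun i j =>
    ⟨w * h i / h j, by
      rintro _ ⟨n, rfl⟩
      exact Matrix.apply_le_div_of_mulVec_le (hnn n) hh.1 (hXh n) i j⟩
  set G : Matrix S S ℝ := Matrix.of fun i j => ⨆ n, X n i j with hG
  have hlim : Tendsto X atTop (𝓝 G) := by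
    refine tendsto_pi_nhds.2 fun i => tendsto_pi_nhds.2 fun j => ?_
    exact tendsto_atTop_ciSup (hmono i j) (hbdd i j)
  have hlim' : ∀ i j, Tendsto (fun n => X n i j) atTop (𝓝 (G i j)) := fun i j =>
    tendsto_atTop_ciSup (hmono i j) (hbdd i j)
  have hcont : Continuous (M.solStep z) := by
    unfold solStep
    fun_prop
  have hfix : M.solStep z G = G := by
    have h1 := (hcont.tendsto G).comp hlim
    have h2 := (tendsto_add_atTop_iff_nat 1).2 hlim
    exact tendsto_nhds_unique (h1.congr fun n => (hsucc n).symm) h2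
  refine ⟨G, ⟨⟨fun i j => ge_of_tendsto' (hlim' i j) fun n => hnn n i j, hfix⟩, ?_⟩, ?_⟩
  · intro Y hY i j
    refine le_of_tendsto' (hlim' i j) fun n => ?_
    induction n generalizing i j with
    | zero => exact hY.1 i j
    | succ n ih =>
      rw [hsucc, ← hY.2]
      exact solStep_mono hz (hnn n) ih i j
  · intro i
    have h1 : Tendsto (fun n => (X n *ᵥ h) i) atTop (𝓝 ((G *ᵥ h) i)) :=
      tendsto_finsetSum _ fun j _ => (hlim' i j).mul_const _
    exact le_of_tendsto' h1 fun n => hXh n i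

end QBD2

namespace QBD2

variable {S : Type*} [Fintype S]

/-! ### The action of the transition kernel on product functions -/

/-- One step, on functions of level and phase, of the process without the boundary `x₁ = 0`,
weighted by `z` to the power of the first increment. -/
noncomputable def levelStep (M : QBD2 S) (z : ℝ) (y : ℕ → S → ℝ) : ℕ → S → ℝ
  | 0 => M.colA1 0 z *ᵥ y 0 + M.colA1 1 z *ᵥ y 1
  | l + 1 => M.colA (-1) z *ᵥ y l + M.colA 0 z *ᵥ y (l + 1) + M.colA 1 z *ᵥ y (l + 2)

/-- The analogue of `levelStep` on the boundary `x₁ = 0`. -/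
noncomputable def levelStepBdry (M : QBD2 S) (z : ℝ) (y : ℕ → S → ℝ) : ℕ → S → ℝ
  | 0 => M.colA0 0 z *ᵥ y 0 + M.colA0 1 z *ᵥ y 1
  | l + 1 => M.colA2 (-1) z *ᵥ y l + M.colA2 0 z *ᵥ y (l + 1) + M.colA2 1 z *ᵥ y (l + 2)

variable {M : QBD2 S}

theorem P_nonneg (x y : ℕ × ℕ × S) : 0 ≤ M.P x y := by
  unfold P
  simp only
  split_ifs with h1 h2 h3 h4 h5 h6
  · exact M.A_nonneg _ h3.1 _ h3.2 _ _
  · exact le_rfl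
  · exact M.A1_nonneg _ h4.1 _ h4.2 _ _
  · exact le_rfl
  · exact M.A2_nonneg _ h6.1 _ h6.2 _ _
  · exact le_rfl
  · rename_i h7
    exact M.A0_nonneg _ h7.1 _ h7.2 _ _
  · exact le_rfl

theorem mem_incH {d : ℤ} : d ∈ incH ↔ d = -1 ∨ d = 0 ∨ d = 1 := by simp [incH]

theorem mem_incHp {d : ℤ} : d ∈ incHp ↔ d = 0 ∨ d = 1 := by simp [incHp]

theorem P_ne_zero {x y : ℕ × ℕ × S} (h : M.P x y ≠ 0) :
    (y.1 ≤ x.1 + 1 ∧ x.1 ≤ y.1 + 1) ∧ (y.2.1 ≤ x.2.1 + 1 ∧ x.2.1 ≤ y.2.1 + 1) := by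
  unfold P at h
  simp only [mem_incH, mem_incHp] at h
  split_ifs at h <;> first | exact absurd rfl h | omega

theorem kernelMean_P_eq_sum (f : ℕ × ℕ × S → ℝ) {x : ℕ × ℕ × S} {s t : Finset ℕ}
    (hs : ∀ a, a ≤ x.1 + 1 → x.1 ≤ a + 1 → a ∈ s)
    (ht : ∀ b, b ≤ x.2.1 + 1 → x.2.1 ≤ b + 1 → b ∈ t) :
    kernelMean M.P f x = ∑ a ∈ s, ∑ b ∈ t, ∑ j, M.P x (a, b, j) * f (a, b, j) := by
  rw [kernelMean, tsum_eq_sum (s := s ×ˢ t ×ˢ (Finset.univ : Finset S)), Finset.sum_product]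
  · exact Finset.sum_congr rfl fun a _ => Finset.sum_product _ _ _
  · intro y hy
    by_contra hne
    have := P_ne_zero (left_ne_zero_of_mul hne)
    apply hy
    simp [Finset.mem_product, hs _ this.1.1 this.1.2, ht _ this.2.1 this.2.2]

theorem finite_support_P (x : ℕ × ℕ × S) : (Function.support (M.P x)).Finite := by
  refine (Finset.finite_toSet (Finset.range (x.1 + 2) ×ˢ Finset.range (x.2.1 + 2) ×ˢ
    (Finset.univ : Finset S))).subset fun y hy => ?_
  have := P_ne_zero hy
  simp only [Finset.coe_product, Set.mem_prod, Finset.coe_range, Set.mem_Iio, Finset.coe_univ,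
    Set.mem_univ, and_true]
  omega

theorem P_interior {k l : ℕ} {i : S} (y : ℕ × ℕ × S) :
    M.P (k + 1, l + 1, i) y = if (y.1 : ℤ) - (k + 1 : ℕ) ∈ incH ∧ (y.2.1 : ℤ) - (l + 1 : ℕ) ∈ incH
      then M.A ((y.1 : ℤ) - (k + 1 : ℕ)) ((y.2.1 : ℤ) - (l + 1 : ℕ)) i y.2.2 else 0 := by
  simp [P]

theorem P_right {k : ℕ} {i : S} (y : ℕ × ℕ × S) :
    M.P (k + 1, 0, i) y = if (y.1 : ℤ) - (k + 1 : ℕ) ∈ incH ∧ (y.2.1 : ℤ) - (0 : ℕ) ∈ incHp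
      then M.A1 ((y.1 : ℤ) - (k + 1 : ℕ)) ((y.2.1 : ℤ) - (0 : ℕ)) i y.2.2 else 0 := by
  simp [P]

theorem P_up {l : ℕ} {i : S} (y : ℕ × ℕ × S) :
    M.P (0, l + 1, i) y = if (y.1 : ℤ) - (0 : ℕ) ∈ incHp ∧ (y.2.1 : ℤ) - (l + 1 : ℕ) ∈ incH
      then M.A2 ((y.1 : ℤ) - (0 : ℕ)) ((y.2.1 : ℤ) - (l + 1 : ℕ)) i y.2.2 else 0 := by
  simp [P]

theorem P_origin {i : S} (y : ℕ × ℕ × S) :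
    M.P (0, 0, i) y = if (y.1 : ℤ) - (0 : ℕ) ∈ incHp ∧ (y.2.1 : ℤ) - (0 : ℕ) ∈ incHp
      then M.A0 ((y.1 : ℤ) - (0 : ℕ)) ((y.2.1 : ℤ) - (0 : ℕ)) i y.2.2 else 0 := by
  simp [P]

theorem sum_window {E : Type*} [AddCommMonoid E] (k : ℕ) (F : ℕ → E) :
    ∑ a ∈ ({k, k + 1, k + 2} : Finset ℕ), F a = F k + F (k + 1) + F (k + 2) := by
  rw [Finset.sum_insert (by simp), Finset.sum_insert (by simp), Finset.sum_singleton, add_assoc]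

theorem sum_window_zero {E : Type*} [AddCommMonoid E] (F : ℕ → E) :
    ∑ a ∈ ({0, 1} : Finset ℕ), F a = F 0 + F 1 := by
  rw [Finset.sum_insert (by simp), Finset.sum_singleton]

theorem sum_incH {E : Type*} [AddCommMonoid E] (F : ℤ → E) :
    ∑ a ∈ incH, F a = F (-1) + F 0 + F 1 := by
  rw [incH, Finset.sum_insert (by simp), Finset.sum_insert (by simp), Finset.sum_singleton,
    add_assoc]

theorem sum_incHp {E : Type*} [AddCommMonoid E] (F : ℤ → E) : ∑ a ∈ incHp, F a = F 0 + F 1 := by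
  rw [incHp, Finset.sum_insert (by simp), Finset.sum_singleton]

theorem sum_mul_mul_eq_mulVec (A : Matrix S S ℝ) (c : ℝ) (v : S → ℝ) (i : S) :
    ∑ j, A i j * (c * v j) = c * (A *ᵥ v) i := by
  rw [Matrix.mulVec, dotProduct, Finset.mul_sum]
  exact Finset.sum_congr rfl fun j _ => by ring

theorem sum_mul_eq_mulVec (A : Matrix S S ℝ) (v : S → ℝ) (i : S) :
    ∑ j, A i j * v j = (A *ᵥ v) i := rfl

theorem kernelMean_P_succ {z : ℝ} (hz : z ≠ 0) (y : ℕ → S → ℝ) (k l : ℕ) (i : S) :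
    kernelMean M.P (fun x => z ^ x.1 * y x.2.1 x.2.2) (k + 1, l, i) =
      z ^ (k + 1) * M.levelStep z y l i := by
  cases l with
  | zero =>
    rw [kernelMean_P_eq_sum (s := {k, k + 1, k + 2}) (t := {0, 1}) _
      (by simp only [Finset.mem_insert, Finset.mem_singleton]; omega)
      (by simp only [Finset.mem_insert, Finset.mem_singleton]; omega)]
    simp only [sum_window, sum_window_zero, P_right, mem_incH, mem_incHp]
    simp [sum_mul_mul_eq_mulVec, levelStep, colA1, sum_incH, Matrix.add_mulVec, Matrix.smul_mulVec]
    field_simp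
    ring
  | succ l =>
    rw [kernelMean_P_eq_sum (s := {k, k + 1, k + 2}) (t := {l, l + 1, l + 2}) _
      (by simp only [Finset.mem_insert, Finset.mem_singleton]; omega)
      (by simp only [Finset.mem_insert, Finset.mem_singleton]; omega)]
    simp only [sum_window, P_interior, mem_incH]
    simp [sum_mul_mul_eq_mulVec, levelStep, colA, sum_incH, Matrix.add_mulVec, Matrix.smul_mulVec]
    field_simp
    ring

theorem kernelMean_P_zero (z : ℝ) (y : ℕ → S → ℝ) (l : ℕ) (i : S) :
    kernelMean M.P (fun x => z ^ x.1 * y x.2.1 x.2.2) (0, l, i) = M.levelStepBdry z y l i := by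
  cases l with
  | zero =>
    rw [kernelMean_P_eq_sum (s := {0, 1}) (t := {0, 1}) _
      (by simp only [Finset.mem_insert, Finset.mem_singleton]; omega)
      (by simp only [Finset.mem_insert, Finset.mem_singleton]; omega)]
    simp only [sum_window_zero, P_origin, mem_incHp]
    simp [sum_mul_mul_eq_mulVec, sum_mul_eq_mulVec, levelStepBdry, colA0, sum_incHp, Matrix.add_mulVec,
      Matrix.smul_mulVec]
    ring
  | succ l =>
    rw [kernelMean_P_eq_sum (s := {0, 1}) (t := {l, l + 1, l + 2}) _
      (by simp only [Finset.mem_insert, Finset.mem_singleton]; omega)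
      (by simp only [Finset.mem_insert, Finset.mem_singleton]; omega)]
    simp only [sum_window, sum_window_zero, P_up, mem_incH, mem_incHp]
    simp [sum_mul_mul_eq_mulVec, sum_mul_eq_mulVec, levelStepBdry, colA2, sum_incHp, Matrix.add_mulVec,
      Matrix.smul_mulVec]
    ring

theorem isFiniteStochastic_P : IsFiniteStochastic M.P := by
  refine ⟨P_nonneg, finite_support_P, fun x => ?_⟩
  obtain ⟨k, l, i⟩ := x
  have h1 : ∑' y, M.P (k, l, i) y =
      kernelMean M.P (fun x => (1 : ℝ) ^ x.1 * (fun _ _ => 1 : ℕ → S → ℝ) x.2.1 x.2.2) (k, l, i) := by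
    simp [kernelMean]
  have hA := M.A_stoch i
  have hA1 := M.A1_stoch i
  have hA2 := M.A2_stoch i
  have hA0 := M.A0_stoch i
  simp only [sum_incH, sum_incHp, Matrix.add_apply, Finset.sum_add_distrib] at hA hA1 hA2 hA0
  rw [h1]
  cases k with
  | zero =>
    refine (kernelMean_P_zero 1 (fun _ _ => (1 : ℝ)) l i).trans ?_
    cases l <;>
    simp [levelStepBdry, colA0, colA2, sum_incHp, Matrix.add_mulVec, Matrix.mulVec, dotProduct] <;> linarith
  | succ k =>
    refine (kernelMean_P_succ one_ne_zero (fun _ _ => (1 : ℝ)) k l i).trans ?_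
    rw [one_pow, one_mul]
    cases l <;>
    simp [levelStep, colA, colA1, sum_incH, Matrix.add_mulVec, Matrix.mulVec, dotProduct] <;> linarith

end QBD2

/-! ### Summability from decay rates -/

theorem summable_mul_pow_of_log_lt_liminf {a : ℕ → ℝ} (ha : ∀ n, 0 ≤ a n) {z : ℝ} (hz : 0 < z)
    (h : ((Real.log z : ℝ) : EReal) <
      liminf (fun n : ℕ => ((-(Real.log (a n)) / n : ℝ) : EReal)) atTop) :
    Summable fun n => a n * z ^ n := by
  obtain ⟨c, hc1, hc2⟩ := EReal.lt_iff_exists_real_btwn.1 h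
  have hzc : Real.log z < c := EReal.coe_lt_coe_iff.1 hc1
  have hr : Real.exp (-c) * z < 1 := by
    rw [← Real.exp_log hz, ← Real.exp_add, Real.exp_lt_one_iff]
    linarith
  refine Summable.of_norm_bounded_eventually_nat (g := fun n => (Real.exp (-c) * z) ^ n)
    (summable_geometric_of_lt_one (by positivity) hr) ?_
  filter_upwards [eventually_lt_of_lt_liminf hc2, eventually_gt_atTop 0] with n hn hn0
  have hn1 : c < -(Real.log (a n)) / n := EReal.coe_lt_coe_iff.1 hn
  have hn0' : (0 : ℝ) < n := Nat.cast_pos.2 hn0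
  rw [lt_div_iff₀ hn0'] at hn1
  rw [Real.norm_of_nonneg (mul_nonneg (ha n) (pow_pos hz n).le), mul_pow]
  refine mul_le_mul_of_nonneg_right ?_ (pow_pos hz n).le
  rcases (ha n).eq_or_lt with h0 | h0
  · rw [← h0]; positivity
  · rw [← Real.exp_nat_mul, ← Real.log_le_iff_le_exp h0]
    linarith

theorem log_lt_of_ofReal_lt_exp {z : ℝ} (hz : 0 < z) {ξ : EReal}
    (h : ENNReal.ofReal z < EReal.exp ξ) : ((Real.log z : ℝ) : EReal) < ξ := by
  rwa [← Real.exp_log hz, ← EReal.exp_coe, EReal.exp_lt_exp_iff] at h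

section

variable {S : Type*} {ν : ℕ → ℕ → S → ℝ}

theorem summable_of_lt_geomRate1 (hν : ∀ k l j, 0 ≤ ν k l j) {z : ℝ} (hz : 0 < z)
    (h : ENNReal.ofReal z < geomRate1 ν) (l : ℕ) (j : S) :
    Summable fun n => ν n l j * z ^ n :=
  summable_mul_pow_of_log_lt_liminf (fun n => hν n l j) hz <|
    (log_lt_of_ofReal_lt_exp hz h).trans_le ((iInf_le _ l).trans (iInf_le _ j))

theorem summable_of_lt_geomRate2 (hν : ∀ k l j, 0 ≤ ν k l j) {w : ℝ} (hw : 0 < w)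
    (h : ENNReal.ofReal w < geomRate2 ν) (k : ℕ) (j : S) :
    Summable fun n => ν k n j * w ^ n :=
  summable_mul_pow_of_log_lt_liminf (fun n => hν k n j) hw <|
    (log_lt_of_ofReal_lt_exp hw h).trans_le ((iInf_le _ k).trans (iInf_le _ j))

end

/-! ### Finite comparison constants -/

section

variable {S : Type*} [Fintype S]

theorem exists_nonneg_le_mul (b : S → ℝ) {g : S → ℝ} (hg : ∀ i, 0 < g i) :
    ∃ c, 0 ≤ c ∧ ∀ i, b i ≤ c * g i := by
  refine ⟨∑ i, |b i| / g i, Finset.sum_nonneg fun i _ => div_nonneg (abs_nonneg _) (hg i).le,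
    fun i => (le_abs_self _).trans ?_⟩
  rw [← div_le_iff₀ (hg i)]
  exact Finset.single_le_sum (f := fun i => |b i| / g i)
    (fun i _ => div_nonneg (abs_nonneg _) (hg i).le) (Finset.mem_univ i)

theorem exists_lt_one_le_mul {b g : S → ℝ} (hg : ∀ i, 0 < g i) (hlt : ∀ i, b i < g i) :
    ∃ ρ, 0 ≤ ρ ∧ ρ < 1 ∧ ∀ i, b i ≤ ρ * g i := by
  rcases isEmpty_or_nonempty S with hS | hS
  · exact ⟨0, le_rfl, one_pos, fun i => hS.elim i⟩
  · obtain ⟨i, -, hi⟩ := Finset.exists_max_image Finset.univ (fun i => b i / g i)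
      Finset.univ_nonempty
    refine ⟨max (b i / g i) 0, le_max_right _ _, max_lt ((div_lt_one (hg i)).2 (hlt i)) one_pos,
      fun j => ?_⟩
    exact (div_le_iff₀ (hg j)).1 ((hi j (Finset.mem_univ _)).trans (le_max_left _ _))

theorem summable_ite_axes {F : ℕ × ℕ × S → ℝ} (hF : ∀ x, 0 ≤ F x)
    (h1 : ∀ j, Summable fun n => F (n, 0, j)) (h2 : ∀ j, Summable fun n => F (0, n, j)) :
    Summable fun x : ℕ × ℕ × S => if x.1 = 0 ∨ x.2.1 = 0 then F x else 0 := by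
  have s1 : Summable fun x : ℕ × ℕ × S => if x.2.1 = 0 then F x else 0 := by
    have hinj : Function.Injective fun q : S × ℕ => ((q.2, 0, q.1) : ℕ × ℕ × S) := by
      rintro ⟨a, b⟩ ⟨c, d⟩ h
      simp only [Prod.mk.injEq] at h
      simp [h.1, h.2.2]
    refine (hinj.summable_iff fun x hx => if_neg fun h => hx ⟨(x.2.2, x.1), ?_⟩).1 ?_
    · simp [← h]
    · refine (summable_prod_of_nonneg fun q => ?_).2 ⟨fun j => ?_, (hasSum_fintype _).summable⟩
      · simpa using hF _
      · simpa using h1 j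
  have s2 : Summable fun x : ℕ × ℕ × S => if x.1 = 0 then F x else 0 := by
    have hinj : Function.Injective fun q : S × ℕ => ((0, q.2, q.1) : ℕ × ℕ × S) := by
      rintro ⟨a, b⟩ ⟨c, d⟩ h
      simp only [Prod.mk.injEq] at h
      simp [h.2.1, h.2.2]
    refine (hinj.summable_iff fun x hx => if_neg fun h => hx ⟨(x.2.2, x.2.1), ?_⟩).1 ?_
    · simp [← h]
    · refine (summable_prod_of_nonneg fun q => ?_).2 ⟨fun j => ?_, (hasSum_fintype _).summable⟩
      · simpa using hF _
      · simpa using h2 j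
  refine Summable.of_nonneg_of_le (fun x => ?_) (fun x => ?_) (s1.add s2)
  · split_ifs
    exacts [hF x, le_rfl]
  · have := hF x
    by_cases a : x.1 = 0 <;> by_cases b : x.2.1 = 0 <;> (simp [a, b]; try linarith)

end

namespace QBD2

variable {S : Type*} [Fintype S] {M : QBD2 S}

theorem levelStep_pow_succ {z w : ℝ} (hw : w ≠ 0) (g : S → ℝ) (l : ℕ) (i : S) :
    M.levelStep z (fun l => w ^ l • g) (l + 1) i = w ^ (l + 1) * (M.C z w *ᵥ g) i := by
  rw [C_eq_colA]
  simp only [levelStep, Matrix.mulVec_smul, Matrix.add_mulVec, Matrix.smul_mulVec, Pi.add_apply,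
    Pi.smul_apply, smul_eq_mul]
  field_simp
  ring

theorem levelStepBdry_pow_succ (z w : ℝ) (g : S → ℝ) (l : ℕ) (i : S) :
    M.levelStepBdry z (fun l => w ^ l • g) (l + 1) i =
      w ^ l * M.levelStepBdry z (fun l => w ^ l • g) 1 i := by
  simp only [levelStepBdry, Matrix.mulVec_smul, Pi.add_apply, Pi.smul_apply, smul_eq_mul]
  ring

variable {ν : ℕ → ℕ → S → ℝ}

theorem IsStationary.hasSum_mul_kernelMean (hν : M.IsStationary ν) {f : ℕ × ℕ × S → ℝ}
    (hf : Summable fun x : ℕ × ℕ × S => ν x.1 x.2.1 x.2.2 * |f x|) :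
    HasSum (fun x : ℕ × ℕ × S => ν x.1 x.2.1 x.2.2 * kernelMean M.P f x)
      (∑' x : ℕ × ℕ × S, ν x.1 x.2.1 x.2.2 * f x) :=
  isFiniteStochastic_P.hasSum_mul_kernelMean (ν := fun x : ℕ × ℕ × S => ν x.1 x.2.1 x.2.2)
    (fun _ => hν.nonneg _ _ _) hν.invariant hf

theorem IsStationary.pos (hν : M.IsStationary ν) (hP : ChainIrreducible M.P)
    (x : ℕ × ℕ × S) : 0 < ν x.1 x.2.1 x.2.2 := by
  obtain ⟨x₀, hx₀⟩ : ∃ x : ℕ × ℕ × S, 0 < ν x.1 x.2.1 x.2.2 := by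
    by_contra! hcon
    have h0 : (fun x : ℕ × ℕ × S => ν x.1 x.2.1 x.2.2) = fun _ => 0 :=
      funext fun x => le_antisymm (hcon x) (hν.nonneg _ _ _)
    have := hν.hasSum_one
    rw [h0] at this
    exact zero_ne_one (hasSum_zero.unique this)
  obtain ⟨n, hn⟩ := hP x₀ x
  refine hn.induction_forward (Q := fun x => 0 < ν x.1 x.2.1 x.2.2) (fun a b hab ha => ?_) hx₀
  exact (mul_pos ha hab).trans_le
    (le_hasSum (hν.invariant b) a fun c _ => mul_nonneg (hν.nonneg _ _ _) (P_nonneg _ _))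

/-- The stationary distribution has a finite moment `z^k w^l` if the moments on the axes are finite
and `C(z,w)` has a strictly subinvariant vector. -/
theorem IsStationary.summable_mul_pow_mul_pow (hν : M.IsStationary ν) {z w : ℝ} (hz : 0 < z)
    (hw : 0 < w) {g : S → ℝ} (hg : M.IsStrictSubinvariant z w g)
    (h1 : ∀ j, Summable fun n => ν n 0 j * z ^ n) (h2 : ∀ j, Summable fun n => ν 0 n j * w ^ n) :
    Summable fun x : ℕ × ℕ × S => ν x.1 x.2.1 x.2.2 * (z ^ x.1 * w ^ x.2.1) := by
  set y : ℕ → S → ℝ := fun l => w ^ l • g with hy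
  set V : ℕ × ℕ × S → ℝ := fun x => z ^ x.1 * y x.2.1 x.2.2 with hVdef
  have hyp : ∀ l i, 0 < y l i := fun l i => mul_pos (pow_pos hw l) (hg.1 i)
  have hV : ∀ x, 0 < V x := fun x => mul_pos (pow_pos hz _) (hyp _ _)
  obtain ⟨ρ, hρ0, hρ1, hρ⟩ := exists_lt_one_le_mul hg.1 hg.2
  obtain ⟨c₁, hc₁, hb₁⟩ := exists_nonneg_le_mul (M.levelStep z y 0) hg.1
  obtain ⟨c₂, hc₂, hb₂⟩ := exists_nonneg_le_mul (M.levelStepBdry z y 1) hg.1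
  obtain ⟨c₃, hc₃, hb₃⟩ := exists_nonneg_le_mul (M.levelStepBdry z y 0) hg.1
  set c := c₁ + c₂ / w + c₃ with hc
  have hc₂w : 0 ≤ c₂ / w := div_nonneg hc₂ hw.le
  have hc0 : 0 ≤ c := by positivity
  have hdrift : ∀ x, kernelMean M.P V x ≤ ρ * V x + if x.1 = 0 ∨ x.2.1 = 0 then c * V x else 0 := by
    rintro ⟨k, l, i⟩
    have hbd : ∀ {r : ℝ}, r ≤ c * V (k, l, i) → r ≤ ρ * V (k, l, i) + c * V (k, l, i) := fun hr =>
      hr.trans (le_add_of_nonneg_left (mul_nonneg hρ0 (hV _).le))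
    cases k with
    | zero =>
      rw [if_pos (Or.inl rfl)]
      refine hbd ?_
      rw [hVdef, kernelMean_P_zero]
      simp only [pow_zero, one_mul]
      cases l with
      | zero =>
        refine (hb₃ i).trans ?_
        simp only [hy, pow_zero, one_smul]
        exact mul_le_mul_of_nonneg_right (by linarith) (hg.1 i).le
      | succ l =>
        rw [hy, levelStepBdry_pow_succ]
        refine (mul_le_mul_of_nonneg_left (hb₂ i) (pow_pos hw l).le).trans ?_
        simp only [Pi.smul_apply, smul_eq_mul]
        calc w ^ l * (c₂ * g i) = c₂ / w * (w ^ (l + 1) * g i) := by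
              field_simp
              ring
          _ ≤ _ := mul_le_mul_of_nonneg_right (by linarith) (hyp (l + 1) i).le
    | succ k =>
      cases l with
      | zero =>
        rw [if_pos (Or.inr rfl)]
        refine hbd ?_
        rw [hVdef, kernelMean_P_succ hz.ne']
        simp only
        rw [mul_left_comm]
        refine mul_le_mul_of_nonneg_left ((hb₁ i).trans ?_) (pow_pos hz _).le
        simp only [hy, pow_zero, one_smul]
        exact mul_le_mul_of_nonneg_right (by linarith) (hg.1 i).le
      | succ l =>
        rw [if_neg (by simp), add_zero, hVdef, kernelMean_P_succ hz.ne', hy,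
          levelStep_pow_succ hw.ne']
        simp only [Pi.smul_apply, smul_eq_mul]
        have := mul_le_mul_of_nonneg_left (hρ i) (mul_pos (pow_pos hz (k + 1))
          (pow_pos hw (l + 1))).le
        linarith
  have hβ : Summable fun x : ℕ × ℕ × S => if x.1 = 0 ∨ x.2.1 = 0 then
      ν x.1 x.2.1 x.2.2 * (c * V x) else 0 := by
    refine summable_ite_axes
      (F := fun x : ℕ × ℕ × S => ν x.1 x.2.1 x.2.2 * (c * V x))
      (fun x => mul_nonneg (hν.nonneg _ _ _) (mul_nonneg hc0 (hV x).le)) (fun j => ?_) fun j => ?_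
    · refine ((h1 j).mul_right (c * g j)).congr fun n => ?_
      simp only [hVdef, hy, pow_zero, one_smul]
      ring
    · refine ((h2 j).mul_right (c * g j)).congr fun n => ?_
      simp only [hVdef, hy, pow_zero, Pi.smul_apply, smul_eq_mul]
      ring
  have hsum := isFiniteStochastic_P.summable_of_drift
    (ν := fun x : ℕ × ℕ × S => ν x.1 x.2.1 x.2.2) (fun x => hν.nonneg _ _ _) hν.invariant
    hν.hasSum_one.summable (fun x => (hV x).le)
    (β := fun x => if x.1 = 0 ∨ x.2.1 = 0 then c * V x else 0) (fun x => by
      split_ifs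
      exacts [mul_nonneg hc0 (hV x).le, le_rfl]) hρ1 (hβ.congr fun x => by
      simp only [mul_ite, mul_zero]) hdrift
  obtain ⟨d, hd, hdg⟩ := exists_nonneg_le_mul (fun _ => 1) hg.1
  refine Summable.of_nonneg_of_le (fun x => mul_nonneg (hν.nonneg _ _ _)
    (mul_nonneg (pow_pos hz _).le (pow_pos hw _).le)) (fun x => ?_) (hsum.mul_left d)
  have := mul_le_mul_of_nonneg_left (hdg x.2.2) (mul_nonneg (hν.nonneg x.1 x.2.1 x.2.2)
    (mul_nonneg (pow_pos hz x.1).le (pow_pos hw x.2.1).le))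
  simp only [hVdef, hy, Pi.smul_apply, smul_eq_mul]
  linarith

theorem IsStationary.summable_of_mem_D1 [DecidableEq S] [Nonempty S] (hν : M.IsStationary ν)
    {z w : ℝ} (hD : (z, w) ∈ M.D1 ν) :
    Summable fun x : ℕ × ℕ × S => ν x.1 x.2.1 x.2.2 * (z ^ x.1 * w ^ x.2.1) := by
  obtain ⟨hz, hw, ⟨z', w'⟩, ⟨hz', hzr, hw', hwr, hlt⟩, hzz, hww⟩ := hD
  simp only at *
  obtain ⟨g, hg⟩ := exists_isStrictSubinvariant hz' hw' hlt
  refine Summable.of_nonneg_of_le (fun x => mul_nonneg (hν.nonneg _ _ _)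
    (mul_nonneg (pow_nonneg hz _) (pow_nonneg hw _))) (fun x => ?_)
    (hν.summable_mul_pow_mul_pow hz' hw' hg
      (fun j => summable_of_lt_geomRate1 hν.nonneg hz' hzr 0 j)
      (fun j => summable_of_lt_geomRate2 hν.nonneg hw' hwr 0 j))
  refine mul_le_mul_of_nonneg_left ?_ (hν.nonneg _ _ _)
  exact mul_le_mul (pow_le_pow_left₀ hz hzz.le _) (pow_le_pow_left₀ hw hww.le _)
    (pow_nonneg hw _) (pow_pos hz' _).le

/-! ### The generating function identity -/

theorem summable_sum_phase {F : ℕ × ℕ × S → ℝ} (hF : Summable F) {a b : ℕ → ℕ}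
    (hab : Function.Injective fun n => (a n, b n)) :
    Summable fun n => ∑ i, F (a n, b n, i) := by
  refine summable_sum fun i _ => hF.comp_injective (i := fun n => (a n, b n, i)) fun m n h => hab ?_
  simp only [Prod.mk.injEq] at h ⊢
  exact ⟨h.1, h.2.1⟩

section Identity

variable [DecidableEq S] {z : ℝ} {G : Matrix S S ℝ}

theorem levelStep_pow_mulVec (hG : M.IsNonnegSol1 z G) (v : S → ℝ) (l : ℕ) :
    M.levelStep z (fun l => (G ^ l) *ᵥ v) (l + 1) = (G ^ (l + 1)) *ᵥ v := by
  have h1 : G ^ (l + 1) =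
      M.colA (-1) z * G ^ l + M.colA 0 z * G ^ (l + 1) + M.colA 1 z * G ^ (l + 2) := by
    have h2 := congrArg (· * G ^ l) hG.2
    simp only [add_mul, mul_assoc] at h2
    rw [← pow_succ', ← pow_add, add_comm 2 l] at h2
    exact h2.symm
  conv_rhs => rw [h1]
  simp only [levelStep, Matrix.add_mulVec, Matrix.mulVec_mulVec]

theorem levelStep_pow_mulVec_zero (v : S → ℝ) :
    M.levelStep z (fun l => (G ^ l) *ᵥ v) 0 = M.C1 z G *ᵥ v := by
  simp [levelStep, C1, Matrix.add_mulVec, Matrix.mulVec_mulVec]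

theorem levelStepBdry_pow_mulVec_zero (v : S → ℝ) :
    M.levelStepBdry z (fun l => (G ^ l) *ᵥ v) 0 = M.C0 z G *ᵥ v := by
  simp [levelStepBdry, C0, Matrix.add_mulVec, Matrix.mulVec_mulVec]

theorem levelStepBdry_pow_mulVec_succ (v : S → ℝ) (l : ℕ) :
    M.levelStepBdry z (fun l => (G ^ l) *ᵥ v) (l + 1) = (M.C2hat z G * G ^ l) *ᵥ v := by
  simp only [levelStepBdry, C2hat, Matrix.mulVec_mulVec, ← Matrix.add_mulVec]
  rw [add_mul, add_mul, mul_assoc, mul_assoc, ← pow_succ', ← pow_add, add_comm 2 l]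

theorem summable_phi1Term (hz : 0 < z)
    (hs : ∀ v : S → ℝ, Summable fun x : ℕ × ℕ × S =>
      ν x.1 x.2.1 x.2.2 * |z ^ x.1 * ((G ^ x.2.1) *ᵥ v) x.2.2|) : Summable (phi1Term ν z) := by
  refine Pi.summable.2 fun j => ?_
  have h1 := (hs fun _ => 1).comp_injective (i := fun n : ℕ => ((n + 1, 0, j) : ℕ × ℕ × S))
    fun m n h => by simpa using h
  refine h1.congr fun n => ?_
  simp [phi1Term, abs_of_pos hz, mul_comm]

theorem summable_phi2Term (hν : M.IsStationary ν)
    (hs : ∀ v : S → ℝ, Summable fun x : ℕ × ℕ × S =>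
      ν x.1 x.2.1 x.2.2 * |z ^ x.1 * ((G ^ x.2.1) *ᵥ v) x.2.2|) : Summable (phi2Term ν G) := by
  refine Pi.summable.2 fun m => ?_
  have h1 : Summable fun x : ℕ × ℕ × S =>
      ν x.1 x.2.1 x.2.2 * (z ^ x.1 * ((G ^ x.2.1) *ᵥ Pi.single m 1) x.2.2) := by
    refine Summable.of_norm ((hs (Pi.single m 1)).congr fun x => ?_)
    rw [norm_mul, Real.norm_of_nonneg (hν.nonneg _ _ _), Real.norm_eq_abs]
  have h2 := summable_sum_phase h1 (a := fun _ => 0) (b := fun n => n + 1)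
    fun m n h => by simpa using h
  refine h2.congr fun n => ?_
  simp [phi2Term, Matrix.vecMul, dotProduct]

theorem summable_phi2C2hatTerm (hν : M.IsStationary ν)
    (hs : ∀ v : S → ℝ, Summable fun x : ℕ × ℕ × S =>
      ν x.1 x.2.1 x.2.2 * |z ^ x.1 * ((G ^ x.2.1) *ᵥ v) x.2.2|) :
    Summable (phi2C2hatTerm M ν z G) := by
  refine Pi.summable.2 fun m => ?_
  have h1 := (hν.hasSum_mul_kernelMean (hs (Pi.single m 1))).summable
  have h2 := summable_sum_phase h1 (a := fun _ => 0) (b := fun n => n + 1)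
    fun m n h => by simpa using h
  refine h2.congr fun n => ?_
  simp only
  have : ∀ i, kernelMean M.P (fun x => z ^ x.1 * ((G ^ x.2.1) *ᵥ Pi.single m 1) x.2.2)
      (0, n + 1, i) = (M.C2hat z G * G ^ n) i m := fun i => by
    rw [kernelMean_P_zero z (fun l => (G ^ l) *ᵥ Pi.single m 1), levelStepBdry_pow_mulVec_succ]
    simp
  simp only [this]
  rfl

theorem phi1_vecMul_eq (hν : M.IsStationary ν) (hz : 0 < z) (hG : M.IsNonnegSol1 z G)
    (hs : ∀ v : S → ℝ, Summable fun x : ℕ × ℕ × S =>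
      ν x.1 x.2.1 x.2.2 * |z ^ x.1 * ((G ^ x.2.1) *ᵥ v) x.2.2|) :
    phi1 ν z ᵥ* (1 - M.C1 z G) =
      phi2C2hat M ν z G - phi2 ν G + ν 0 0 ᵥ* (M.C0 z G - 1) := by
  have s1 := summable_phi1Term hz hs
  have s2 := summable_phi2Term hν hs
  have s3 := summable_phi2C2hatTerm hν hs
  ext m
  set y : ℕ → S → ℝ := fun l => (G ^ l) *ᵥ Pi.single m 1 with hy
  set f : ℕ × ℕ × S → ℝ := fun x => z ^ x.1 * y x.2.1 x.2.2 with hf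
  set D : ℕ × ℕ × S → ℝ := fun x =>
    ν x.1 x.2.1 x.2.2 * f x - ν x.1 x.2.1 x.2.2 * kernelMean M.P f x with hDdef
  have hfs : Summable fun x : ℕ × ℕ × S => ν x.1 x.2.1 x.2.2 * f x := by
    refine Summable.of_norm ((hs (Pi.single m 1)).congr fun x => ?_)
    rw [norm_mul, Real.norm_of_nonneg (hν.nonneg _ _ _), Real.norm_eq_abs]
  have hD : HasSum D 0 := by
    have h := hfs.hasSum.sub (hν.hasSum_mul_kernelMean (hs (Pi.single m 1)))
    rwa [sub_self] at h
  have hf_apply : ∀ k l i, f (k, l, i) = z ^ k * (G ^ l) i m := fun k l i => by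
    simp [hf, hy]
  have hsucc_apply : ∀ k l i, kernelMean M.P f (k + 1, l, i) = z ^ (k + 1) * M.levelStep z y l i :=
    kernelMean_P_succ hz.ne' y
  have hzero_apply : ∀ l i, kernelMean M.P f (0, l, i) = M.levelStepBdry z y l i :=
    kernelMean_P_zero z y
  have hDint : ∀ k l i, D (k + 1, l + 1, i) = 0 := by
    intro k l i
    simp only [hDdef, hsucc_apply, hf_apply, hy, levelStep_pow_mulVec hG]
    simp
  have hDright : ∀ k i, D (k + 1, 0, i) = phi1Term ν z k i * (1 - M.C1 z G) i m := by
    intro k i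
    simp only [hDdef, hsucc_apply, hf_apply, hy, levelStep_pow_mulVec_zero]
    simp [phi1Term]
    ring
  have hDup : ∀ l i, D (0, l + 1, i) =
      ν 0 (l + 1) i * (G ^ (l + 1)) i m - ν 0 (l + 1) i * (M.C2hat z G * G ^ l) i m := by
    intro l i
    simp only [hDdef, hzero_apply, hf_apply, hy, levelStepBdry_pow_mulVec_succ]
    simp
  have hDorig : ∀ i, D (0, 0, i) = - (ν 0 0 i * (M.C0 z G - 1) i m) := by
    intro i
    simp only [hDdef, hzero_apply, hf_apply, hy, levelStepBdry_pow_mulVec_zero]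
    simp
    ring
  have hin : ∀ k, HasSum (fun q : ℕ × S => D (k, q)) (∑' l, ∑ i, D (k, l, i)) := by
    intro k
    have hsk : Summable fun q : ℕ × S => D (k, q) := hD.summable.prod_factor k
    have := hsk.hasSum.prod_fiberwise fun l => hasSum_fintype fun i => D (k, l, i)
    rw [this.tsum_eq]
    exact hsk.hasSum
  have hout := hD.prod_fiberwise hin
  have hsucc : ∀ k, ∑' l, ∑ i, D (k + 1, l, i) = ∑ i, phi1Term ν z k i * (1 - M.C1 z G) i m := by
    intro k
    rw [tsum_eq_single 0]
    · exact Finset.sum_congr rfl fun i _ => hDright k i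
    · intro l hl
      obtain ⟨l, rfl⟩ := Nat.exists_eq_succ_of_ne_zero hl
      exact Finset.sum_eq_zero fun i _ => hDint k l i
  have hzero : ∑' l, ∑ i, D (0, l, i) =
      -(ν 0 0 ᵥ* (M.C0 z G - 1)) m + (phi2 ν G m - phi2C2hat M ν z G m) := by
    have e2 : HasSum (fun l => phi2Term ν G l m) (phi2 ν G m) := Pi.hasSum.1 s2.hasSum m
    have e3 : HasSum (fun l => phi2C2hatTerm M ν z G l m) (phi2C2hat M ν z G m) :=
      Pi.hasSum.1 s3.hasSum m
    have h0 : ∑ i, D (0, 0, i) = -(ν 0 0 ᵥ* (M.C0 z G - 1)) m := by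
      simp only [hDorig, Finset.sum_neg_distrib]
      rfl
    have h1 : ∀ l, ∑ i, D (0, l + 1, i) = phi2Term ν G l m - phi2C2hatTerm M ν z G l m := by
      intro l
      simp only [hDup, Finset.sum_sub_distrib]
      rfl
    have e := (e2.sub e3).congr_fun h1 |>.zero_add (f := fun l => ∑ i, D (0, l, i))
    rw [h0] at e
    exact e.tsum_eq
  have e1 : HasSum (fun k => phi1Term ν z k) (phi1 ν z) := s1.hasSum
  have e1' : HasSum (fun k => ∑ i, phi1Term ν z k i * (1 - M.C1 z G) i m)
      ((phi1 ν z ᵥ* (1 - M.C1 z G)) m) :=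
    hasSum_sum fun i _ => (Pi.hasSum.1 e1 i).mul_right _
  have e := (e1'.congr_fun hsucc).zero_add (f := fun k => ∑' l, ∑ i, D (k, l, i))
  have := hout.unique e
  rw [hzero] at this
  simp only [Pi.add_apply, Pi.sub_apply]
  linarith

end Identity

end QBD2

/-- Jensen's inequality, with its equality case, for powers of a positive harmonic function. -/
theorem IsFiniteStochastic.kernelMean_rpow_le {α : Type*} {p : α → α → ℝ}
    (hp : IsFiniteStochastic p) {f : α → ℝ} (hf : ∀ x, 0 < f x) {x : α}
    (hx : kernelMean p f x = f x) {r : ℝ} (hr0 : 0 < r) (hr1 : r < 1) :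
    kernelMean p (fun y => f y ^ r) x ≤ f x ^ r ∧
      (f x ^ r ≤ kernelMean p (fun y => f y ^ r) x → ∀ y, 0 < p x y → f y = f x) := by
  set a := f x with ha
  have ha0 : 0 < a := hf x
  have har : 0 < a ^ r := Real.rpow_pos_of_pos ha0 r
  set φ : α → ℝ := fun y => a ^ r * (r / a) * f y - a ^ r * (r - 1) with hφ
  have hfy : ∀ y, f y ^ r = a ^ r * (1 + (f y / a - 1)) ^ r := fun y => by
    rw [← Real.mul_rpow ha0.le (by have := div_pos (hf y) ha0; linarith)]
    congr 1
    field_simp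
    ring
  have hφy : ∀ y, φ y = a ^ r * (1 + r * (f y / a - 1)) := fun y => by
    simp only [hφ]
    field_simp
    ring
  have hs : ∀ y, -1 ≤ f y / a - 1 := fun y => by have := div_pos (hf y) ha0; linarith
  have hle : ∀ y, f y ^ r ≤ φ y := fun y => by
    rw [hfy, hφy]
    exact mul_le_mul_of_nonneg_left (rpow_one_add_le_one_add_mul_self (hs y) hr0.le hr1.le) har.le
  have hmean : kernelMean p φ x = a ^ r := by
    rw [hφ, hp.kernelMean_sub, kernelMean_const_mul, hp.kernelMean_const, hx]
    field_simp
    ring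
  refine ⟨(hp.kernelMean_mono hle x).trans hmean.le, fun h y hy => ?_⟩
  have heq := hp.eq_of_kernelMean_le hle (hmean.le.trans h) hy
  by_contra hne
  have hlt := rpow_one_add_lt_one_add_mul_self (hs y)
    (fun h0 => hne (by field_simp at h0; linarith)) hr0 hr1
  rw [hfy, hφy] at heq
  exact (mul_lt_mul_of_pos_left hlt har).ne heq

namespace QBD2

variable {S : Type*} [Fintype S] {M : QBD2 S}

/-! ### The level operator -/

/-- `levelStep` as a linear endomorphism. -/
noncomputable def levelOp (M : QBD2 S) (z : ℝ) : Module.End ℝ (ℕ → S → ℝ) where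
  toFun := M.levelStep z
  map_add' y y' := by
    funext l
    cases l <;> simp only [levelStep, Pi.add_apply, Matrix.mulVec_add] <;> abel
  map_smul' c y := by
    funext l
    cases l <;> simp only [levelStep, Pi.smul_apply, Matrix.mulVec_smul, smul_add,
      RingHom.id_apply]

theorem levelOp_apply (z : ℝ) (y : ℕ → S → ℝ) : M.levelOp z y = M.levelStep z y := rfl

theorem mul_levelOp_eq_kernelMean {z : ℝ} (hz : z ≠ 0) (y : ℕ → S → ℝ) (l : ℕ) (i : S) :
    z * M.levelOp z y l i = kernelMean M.P (fun x => z ^ x.1 * y x.2.1 x.2.2) (1, l, i) := by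
  have := kernelMean_P_succ (M := M) hz y 0 l i
  rw [zero_add, pow_one] at this
  exact this.symm

theorem levelOp_nonneg {z : ℝ} (hz : 0 < z) {y : ℕ → S → ℝ} (hy : ∀ l i, 0 ≤ y l i) (l : ℕ)
    (i : S) : 0 ≤ M.levelOp z y l i := by
  refine nonneg_of_mul_nonneg_right ?_ hz
  rw [mul_levelOp_eq_kernelMean hz.ne']
  exact tsum_nonneg fun x => mul_nonneg (P_nonneg _ _) (mul_nonneg (pow_pos hz _).le (hy _ _))

theorem levelOp_mono {z : ℝ} (hz : 0 < z) {y y' : ℕ → S → ℝ} (hy : ∀ l i, y l i ≤ y' l i) (l : ℕ)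
    (i : S) : M.levelOp z y l i ≤ M.levelOp z y' l i := by
  have h := levelOp_nonneg (M := M) hz (y := y' - y) (fun l i => sub_nonneg.2 (hy l i)) l i
  rw [map_sub] at h
  exact sub_nonneg.1 h

theorem levelOp_pow_nonneg {z : ℝ} (hz : 0 < z) {y : ℕ → S → ℝ} (hy : ∀ l i, 0 ≤ y l i) (m : ℕ)
    (l : ℕ) (i : S) : 0 ≤ (M.levelOp z ^ m) y l i := by
  induction m generalizing l i with
  | zero => exact hy l i
  | succ m ih =>
    rw [pow_succ', Module.End.mul_apply]
    exact levelOp_nonneg hz ih l i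

/-- Transitions of the process without the boundary `x₁ = 0` are transitions of the process
from the states with `x₁ = 1`. -/
theorem exists_P_pos_of_PFree1_pos {a b : ℤ} {l l' : ℕ} {i i' : S}
    (h : 0 < M.PFree1 (a, l, i) (b, l', i')) :
    ∃ k : ℕ, 0 < M.P (1, l, i) (k, l', i') ∧ (k : ℤ) = b - a + 1 := by
  have hd : b - a ∈ incH := by
    by_contra hd
    unfold PFree1 at h
    simp [hd] at h
  obtain ⟨k, hk⟩ : ∃ k : ℕ, (k : ℤ) = b - a + 1 :=
    ⟨(b - a + 1).toNat, Int.toNat_of_nonneg (by rw [mem_incH] at hd; omega)⟩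
  refine ⟨k, ?_, hk⟩
  have hk' : (k : ℤ) - ((1 : ℕ) : ℤ) = b - a := by push_cast; omega
  unfold P
  unfold PFree1 at h
  simp only [hk', ne_eq, one_ne_zero, not_false_eq_true, if_true] at h ⊢
  exact h

theorem levelOp_pos_of_PFree1_pos {z : ℝ} (hz : 0 < z) {y : ℕ → S → ℝ} (hy : ∀ l i, 0 ≤ y l i)
    {a b : ℤ} {l l' : ℕ} {i i' : S} (h : 0 < M.PFree1 (a, l, i) (b, l', i'))
    (hpos : 0 < y l' i') : 0 < M.levelOp z y l i := by
  obtain ⟨k, hk, -⟩ := exists_P_pos_of_PFree1_pos h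
  refine pos_of_mul_pos_right (b := M.levelOp z y l i) (a := z) ?_ hz.le
  rw [mul_levelOp_eq_kernelMean hz.ne']
  exact (mul_pos hk (mul_pos (pow_pos hz k) hpos)).trans_le <|
    isFiniteStochastic_P.mul_le_kernelMean (f := fun x : ℕ × ℕ × S => z ^ x.1 * y x.2.1 x.2.2)
      (fun x => mul_nonneg (pow_pos hz _).le (hy _ _)) (1, l, i) (k, l', i')

theorem levelOp_pow_pos_of_reachIn {z : ℝ} (hz : 0 < z) {y : ℕ → S → ℝ} (hy : ∀ l i, 0 ≤ y l i)
    {m : ℕ} {x x' : ℤ × ℕ × S} (h : ReachIn M.PFree1 m x x') (hpos : 0 < y x'.2.1 x'.2.2) :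
    0 < (M.levelOp z ^ m) y x.2.1 x.2.2 := by
  induction m generalizing x with
  | zero => rw [show x = x' from h]; exact hpos
  | succ m ih =>
    obtain ⟨u, hu, hr⟩ := h
    rw [pow_succ', Module.End.mul_apply]
    exact levelOp_pos_of_PFree1_pos (i' := u.2.2) (l' := u.2.1) (b := u.1) (a := x.1) hz
      (levelOp_pow_nonneg hz hy m) hu (ih hr)

/-- Averaging a subharmonic function which is not harmonic makes it strictly subharmonic
at level zero. -/
theorem exists_sum_levelOp_pow_strict (hFree1 : ChainIrreducible M.PFree1) {z : ℝ} (hz : 0 < z)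
    {y : ℕ → S → ℝ} (hy : ∀ l i, y l i ≤ M.levelOp z y l i) {l₀ : ℕ} {i₀ : S}
    (hlt : y l₀ i₀ < M.levelOp z y l₀ i₀) :
    ∃ n : ℕ, (∀ l i, (∑ m ∈ Finset.range (n + 1), (M.levelOp z ^ m) y) l i ≤
        M.levelOp z (∑ m ∈ Finset.range (n + 1), (M.levelOp z ^ m) y) l i) ∧
      ∀ i, (∑ m ∈ Finset.range (n + 1), (M.levelOp z ^ m) y) 0 i <
        M.levelOp z (∑ m ∈ Finset.range (n + 1), (M.levelOp z ^ m) y) 0 i := by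
  set d := M.levelOp z y - y with hd
  have hd0 : ∀ l i, 0 ≤ d l i := fun l i => sub_nonneg.2 (hy l i)
  have hnn := levelOp_pow_nonneg (M := M) hz hd0
  choose r hr using fun i => hFree1 (0, 0, i) (0, l₀, i₀)
  have hdiff : ∀ n : ℕ, ∀ l i, M.levelOp z (∑ m ∈ Finset.range (n + 1), (M.levelOp z ^ m) y) l i -
      (∑ m ∈ Finset.range (n + 1), (M.levelOp z ^ m) y) l i =
      ∑ m ∈ Finset.range (n + 1), (M.levelOp z ^ m) d l i := by
    intro n l i
    have : M.levelOp z (∑ m ∈ Finset.range (n + 1), (M.levelOp z ^ m) y) -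
        ∑ m ∈ Finset.range (n + 1), (M.levelOp z ^ m) y =
        ∑ m ∈ Finset.range (n + 1), (M.levelOp z ^ m) d := by
      rw [map_sum, ← Finset.sum_sub_distrib]
      refine Finset.sum_congr rfl fun m _ => ?_
      rw [hd, map_sub, ← Module.End.mul_apply, ← Module.End.mul_apply, ← pow_succ, ← pow_succ']
    have h2 := congrFun (congrFun this l) i
    rw [Finset.sum_apply, Finset.sum_apply] at h2
    exact h2
  refine ⟨∑ i, r i, fun l i => sub_nonneg.1 ?_, fun i => sub_pos.1 ?_⟩
  · rw [hdiff]
    exact Finset.sum_nonneg fun m _ => hnn m l i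
  · rw [hdiff]
    refine Finset.sum_pos' (fun m _ => hnn m 0 i) ⟨r i, ?_, ?_⟩
    · have := Finset.single_le_sum (f := r) (fun _ _ => Nat.zero_le _) (Finset.mem_univ i)
      exact Finset.mem_range.2 (Nat.lt_succ_of_le this)
    · exact levelOp_pow_pos_of_reachIn hz hd0 (hr i) (sub_pos.2 hlt)

/-- The level operator preserves geometric growth. -/
theorem exists_levelOp_le {z w : ℝ} (hz : 0 < z) (hw : 0 < w) {y : ℕ → S → ℝ} {c : ℝ}
    (hc : 0 ≤ c) (hy : ∀ l i, y l i ≤ c * w ^ l) :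
    ∃ c', 0 ≤ c' ∧ ∀ l i, M.levelOp z y l i ≤ c' * w ^ l := by
  obtain ⟨c₀, hc₀, h₀⟩ := exists_nonneg_le_mul
    (M.levelStep z (fun l => w ^ l • fun _ => (1 : ℝ)) 0) (g := fun _ => 1) fun _ => one_pos
  obtain ⟨c₁, hc₁, h₁⟩ := exists_nonneg_le_mul
    (M.C z w *ᵥ fun _ => (1 : ℝ)) (g := fun _ => 1) fun _ => one_pos
  refine ⟨c * (c₀ + c₁), by positivity, fun l i => ?_⟩
  have h1 := levelOp_mono (M := M) hz (y' := c • fun l => w ^ l • fun _ => (1 : ℝ))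
    (fun l i => by simpa using hy l i) l i
  rw [map_smul] at h1
  refine h1.trans ?_
  rw [Pi.smul_apply, Pi.smul_apply, smul_eq_mul, mul_assoc, levelOp_apply]
  refine mul_le_mul_of_nonneg_left ?_ hc
  cases l with
  | zero => have := h₀ i; rw [pow_zero]; linarith
  | succ l =>
    rw [levelStep_pow_succ hw.ne', mul_comm]
    exact mul_le_mul_of_nonneg_right (by have := h₁ i; linarith) (pow_pos hw _).le

theorem exists_levelOp_pow_le {z w : ℝ} (hz : 0 < z) (hw : 0 < w) {y : ℕ → S → ℝ} {c : ℝ}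
    (hc : 0 ≤ c) (hy : ∀ l i, y l i ≤ c * w ^ l) (m : ℕ) :
    ∃ c', 0 ≤ c' ∧ ∀ l i, (M.levelOp z ^ m) y l i ≤ c' * w ^ l := by
  induction m with
  | zero => exact ⟨c, hc, hy⟩
  | succ m ih =>
    obtain ⟨c', hc', h'⟩ := ih
    rw [pow_succ']
    exact exists_levelOp_le hz hw hc' h'

theorem exists_sum_levelOp_pow_le {z w : ℝ} (hz : 0 < z) (hw : 0 < w) {y : ℕ → S → ℝ} {c : ℝ}
    (hc : 0 ≤ c) (hy : ∀ l i, y l i ≤ c * w ^ l) (n : ℕ) :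
    ∃ c', 0 ≤ c' ∧ ∀ l i, (∑ m ∈ Finset.range n, (M.levelOp z ^ m) y) l i ≤ c' * w ^ l := by
  choose c' hc' h' using exists_levelOp_pow_le (M := M) hz hw hc hy
  refine ⟨∑ m ∈ Finset.range n, c' m, Finset.sum_nonneg fun m _ => hc' m, fun l i => ?_⟩
  rw [Finset.sum_apply, Finset.sum_apply, Finset.sum_mul]
  exact Finset.sum_le_sum fun m _ => h' m l i

/-! ### Exclusion of subharmonic functions -/

/-- The stationary process admits no subharmonic function off the boundary `x₁ = 0` which is
integrable, bounded above on this boundary and unbounded. -/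
theorem IsStationary.false_of_subharmonic {ν : ℕ → ℕ → S → ℝ} (hν : M.IsStationary ν)
    (hP : ChainIrreducible M.P) {z z₁ w w₁ : ℝ} (hz : 1 < z) (hz₁ : 0 < z₁) (hzz : z₁ < z)
    (hw : 0 < w) (hww : w < w₁)
    (hs : Summable fun x : ℕ × ℕ × S => ν x.1 x.2.1 x.2.2 * (z ^ x.1 * w ^ x.2.1))
    {u v : ℕ → S → ℝ} {c c₁ : ℝ} (hc : 0 ≤ c) (hc₁ : 0 < c₁)
    (hu : ∀ l i, u l i ≤ c * w ^ l) {j : S} (hj : 0 < u 0 j)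
    (hv : ∀ l i, c₁ * w₁ ^ l ≤ v l i)
    (hsub : ∀ k l i, z ^ (k + 1) * u l i - z₁ ^ (k + 1) * v l i ≤
      z ^ (k + 1) * M.levelOp z u l i - z₁ ^ (k + 1) * M.levelOp z₁ v l i) : False := by
  have hz0 : 0 < z := one_pos.trans hz
  have hw₁ : 0 < w₁ := hw.trans hww
  have hv0 : ∀ l i, 0 ≤ v l i := fun l i => (mul_pos hc₁ (pow_pos hw₁ l)).le.trans (hv l i)
  obtain ⟨N, hN0, hN⟩ : ∃ N : ℝ, 0 ≤ N ∧ ∀ l i, u l i - v l i ≤ N := by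
    have hlim : Tendsto (fun l : ℕ => c * (w / w₁) ^ l) atTop (𝓝 (c * 0)) :=
      (tendsto_pow_atTop_nhds_zero_of_lt_one (div_pos hw hw₁).le
        ((div_lt_one hw₁).2 hww)).const_mul c
    rw [mul_zero] at hlim
    obtain ⟨L, hL⟩ := eventually_atTop.1 (hlim.eventually_le_const hc₁)
    refine ⟨∑ l ∈ Finset.range L, c * w ^ l, Finset.sum_nonneg fun l _ =>
      mul_nonneg hc (pow_pos hw l).le, fun l i => ?_⟩
    rcases lt_or_ge l L with hl | hl
    · have := Finset.single_le_sum (f := fun l => c * w ^ l)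
        (fun l _ => mul_nonneg hc (pow_pos hw l).le) (Finset.mem_range.2 hl)
      linarith [hu l i, hv0 l i]
    · have h1 := mul_le_mul_of_nonneg_right (hL l hl) (pow_pos hw₁ l).le
      rw [div_pow, mul_assoc, div_mul_cancel₀ _ (pow_pos hw₁ l).ne'] at h1
      have h2 : u l i - v l i ≤ 0 := by linarith [hu l i, hv l i]
      exact h2.trans (Finset.sum_nonneg fun l _ => mul_nonneg hc (pow_pos hw l).le)
  set Ψ : ℕ × ℕ × S → ℝ := fun x => z ^ x.1 * u x.2.1 x.2.2 - z₁ ^ x.1 * v x.2.1 x.2.2 with hΨ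
  set g : ℕ × ℕ × S → ℝ := fun x => max (Ψ x) N with hg
  have hker := isFiniteStochastic_P (M := M)
  have hgN : ∀ x, N ≤ g x := fun x => le_max_right _ _
  have hg0 : ∀ x, 0 ≤ g x := fun x => hN0.trans (hgN x)
  have hgle : ∀ x, g x ≤ c * (z ^ x.1 * w ^ x.2.1) + N := by
    intro x
    have h1 : 0 ≤ c * (z ^ x.1 * w ^ x.2.1) :=
      mul_nonneg hc (mul_pos (pow_pos hz0 _) (pow_pos hw _)).le
    refine max_le ?_ (by linarith)
    have h2 := mul_le_mul_of_nonneg_left (hu x.2.1 x.2.2) (pow_pos hz0 x.1).le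
    have h3 := mul_nonneg (pow_pos hz₁ x.1).le (hv0 x.2.1 x.2.2)
    simp only [hΨ]
    linarith
  have hgs : Summable fun x : ℕ × ℕ × S => ν x.1 x.2.1 x.2.2 * |g x| := by
    refine Summable.of_nonneg_of_le (fun x => mul_nonneg (hν.nonneg _ _ _) (abs_nonneg _))
      (fun x => ?_) ((hs.mul_left c).add (hν.hasSum_one.summable.mul_right N))
    rw [abs_of_nonneg (hg0 x)]
    have := mul_le_mul_of_nonneg_left (hgle x) (hν.nonneg x.1 x.2.1 x.2.2)
    linarith
  have hgsub : ∀ x, g x ≤ kernelMean M.P g x := by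
    intro x
    have hNle : N ≤ kernelMean M.P g x :=
      (hker.kernelMean_const N x).ge.trans (hker.kernelMean_mono hgN x)
    refine max_le ?_ hNle
    obtain ⟨k, l, i⟩ := x
    cases k with
    | zero =>
      refine le_trans ?_ hNle
      simpa [hΨ] using hN l i
    | succ k =>
      refine le_trans ?_ (hker.kernelMean_mono (fun y => le_max_left (Ψ y) N) _)
      rw [hΨ, hker.kernelMean_sub, kernelMean_P_succ hz0.ne', kernelMean_P_succ hz₁.ne']
      exact hsub k l i
  obtain ⟨k, hk⟩ : ∃ k : ℕ, N < Ψ (k, 0, j) := by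
    have h1 : Tendsto (fun k : ℕ => u 0 j - (z₁ / z) ^ k * v 0 j) atTop (𝓝 (u 0 j - 0 * v 0 j)) :=
      tendsto_const_nhds.sub ((tendsto_pow_atTop_nhds_zero_of_lt_one (div_pos hz₁ hz0).le
        ((div_lt_one hz0).2 hzz)).mul_const _)
    rw [zero_mul, sub_zero] at h1
    have h2 := (tendsto_pow_atTop_atTop_of_one_lt hz).atTop_mul_pos hj h1
    obtain ⟨k, hk⟩ := (h2.eventually_gt_atTop N).exists
    refine ⟨k, hk.trans_le (le_of_eq ?_)⟩
    simp only [hΨ, div_pow]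
    have := (pow_pos hz0 k).ne'
    field_simp
  obtain ⟨n, hn⟩ := hP (0, 0, j) (k, 0, j)
  have hstart : g (0, 0, j) = N := by
    simp only [hg]
    refine max_eq_right ?_
    simpa [hΨ] using hN 0 j
  have hend := hker.eq_of_reachIn (ν := fun x : ℕ × ℕ × S => ν x.1 x.2.1 x.2.2)
    (fun x => hν.nonneg _ _ _) hν.invariant (fun x => hν.pos hP x) hgN hgsub hgs hn hstart
  exact (hk.trans_le (le_max_left _ N)).ne' hend

/-- Powers of a positive harmonic function are superharmonic, and not harmonic if `z ≠ 1`. -/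
theorem levelOp_rpow_le (hFree1 : ChainIrreducible M.PFree1) [Nonempty S] {z : ℝ} (hz : 1 < z)
    {y : ℕ → S → ℝ} (hy0 : ∀ l i, 0 < y l i) (hy : M.levelOp z y = y) {r : ℝ} (hr0 : 0 < r)
    (hr1 : r < 1) :
    (∀ l i, M.levelOp (z ^ r) (fun l i => y l i ^ r) l i ≤ y l i ^ r) ∧
      ∃ l i, M.levelOp (z ^ r) (fun l i => y l i ^ r) l i < y l i ^ r := by
  have hz0 : 0 < z := one_pos.trans hz
  have hzr : 0 < z ^ r := Real.rpow_pos_of_pos hz0 r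
  set f : ℕ × ℕ × S → ℝ := fun x => z ^ x.1 * y x.2.1 x.2.2 with hf
  have hf0 : ∀ x, 0 < f x := fun x => mul_pos (pow_pos hz0 _) (hy0 _ _)
  have hfr : ∀ x, f x ^ r = (z ^ r) ^ x.1 * y x.2.1 x.2.2 ^ r := fun x => by
    rw [hf, Real.mul_rpow (pow_pos hz0 _).le (hy0 _ _).le, ← Real.rpow_natCast,
      ← Real.rpow_natCast, ← Real.rpow_mul hz0.le, ← Real.rpow_mul hz0.le, mul_comm (x.1 : ℝ) r]
  have hharm : ∀ l i, kernelMean M.P f (1, l, i) = f (1, l, i) := fun l i => by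
    rw [hf, ← mul_levelOp_eq_kernelMean hz0.ne', hy]
    simp only [pow_one]
  have hmean : ∀ l i, kernelMean M.P (fun x => f x ^ r) (1, l, i) =
      z ^ r * M.levelOp (z ^ r) (fun l i => y l i ^ r) l i := fun l i => by
    rw [mul_levelOp_eq_kernelMean hzr.ne']
    simp only [hfr]
  have hf1 : ∀ l i, f (1, l, i) ^ r = z ^ r * y l i ^ r := fun l i => by rw [hfr, pow_one]
  have hJ := fun l i => isFiniteStochastic_P.kernelMean_rpow_le hf0 (hharm l i) hr0 hr1
  constructor
  · intro l i
    have := (hJ l i).1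
    rw [hmean, hf1] at this
    exact le_of_mul_le_mul_left this hzr
  · by_contra! hcon
    have hedge : ∀ x x' : ℤ × ℕ × S, 0 < M.PFree1 x x' →
        z ^ x'.1 * y x'.2.1 x'.2.2 = z ^ x.1 * y x.2.1 x.2.2 := by
      rintro ⟨a, l, i⟩ ⟨b, l', i'⟩ h
      obtain ⟨k, hk, hkab⟩ := exists_P_pos_of_PFree1_pos h
      have h1 := (hJ l i).2 (by
        rw [hmean, hf1]
        exact mul_le_mul_of_nonneg_left (hcon l i) hzr.le) (k, l', i') hk
      simp only [hf, pow_one] at h1 ⊢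
      rw [← zpow_natCast, hkab, zpow_add₀ hz0.ne', zpow_sub₀ hz0.ne', zpow_one] at h1
      have := (zpow_pos hz0 a).ne'
      field_simp at h1
      linarith
    obtain ⟨j⟩ := ‹Nonempty S›
    obtain ⟨n, hn⟩ := hFree1 (0, 0, j) (1, 0, j)
    have h2 := hn.induction_forward (Q := fun x => z ^ x.1 * y x.2.1 x.2.2 = y 0 j)
      (fun x x' h hx => (hedge x x' h).trans hx) (by simp)
    simp only [zpow_one] at h2
    nlinarith [hy0 0 j]

/-! ### Nonsingularity -/

section Nonsingular

theorem C1_nonneg {z : ℝ} (hz : 0 ≤ z) {G : Matrix S S ℝ} (hG : ∀ i j, 0 ≤ G i j) (i j : S) :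
    0 ≤ M.C1 z G i j :=
  add_nonneg (colA1_nonneg (by decide) hz i j)
    (Matrix.mul_apply_nonneg (colA1_nonneg (by decide) hz) hG i j)

variable [DecidableEq S]

theorem exists_nonneg_le_mulVec_of_not_isUnit {K : Matrix S S ℝ} (hK : ∀ i j, 0 ≤ K i j)
    (hsing : ¬IsUnit (1 - K)) :
    ∃ u : S → ℝ, (∀ i, 0 ≤ u i) ∧ (∃ i, 0 < u i) ∧ ∀ i, u i ≤ (K *ᵥ u) i := by
  have hdet : (1 - K).det = 0 := by
    by_contra hne
    exact hsing ((Matrix.isUnit_iff_isUnit_det _).2 (isUnit_iff_ne_zero.2 hne))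
  obtain ⟨v, hv0, hv⟩ := Matrix.exists_mulVec_eq_zero_iff.2 hdet
  rw [Matrix.sub_mulVec, Matrix.one_mulVec, sub_eq_zero] at hv
  obtain ⟨i, hi⟩ := Function.ne_iff.1 hv0
  refine ⟨fun i => |v i|, fun i => abs_nonneg _, ⟨i, abs_pos.2 hi⟩, fun i => ?_⟩
  calc |v i| = |(K *ᵥ v) i| := by rw [← hv]
    _ ≤ ∑ j, |K i j * v j| := Finset.abs_sum_le_sum_abs _ _
    _ = (K *ᵥ fun i => |v i|) i :=
        Finset.sum_congr rfl fun j _ => by rw [abs_mul, abs_of_nonneg (hK i j)]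

theorem exists_pow_mulVec_le {G : Matrix S S ℝ} (hG : ∀ i j, 0 ≤ G i j) {h : S → ℝ}
    (hh : ∀ i, 0 < h i) {w : ℝ} (hw : 0 < w) (hle : ∀ i, (G *ᵥ h) i ≤ w * h i) (u : S → ℝ) :
    ∃ c, 0 ≤ c ∧ ∀ l i, ((G ^ l) *ᵥ u) i ≤ c * w ^ l := by
  obtain ⟨a, ha, hua⟩ := exists_nonneg_le_mul u hh
  obtain ⟨b, hb, hhb⟩ := exists_nonneg_le_mul h (g := fun _ => 1) fun _ => one_pos
  refine ⟨a * b, mul_nonneg ha hb, fun l i => ?_⟩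
  have h1 := Matrix.mulVec_apply_mono (Matrix.pow_apply_nonneg hG l) (v := a • h) hua i
  rw [Matrix.mulVec_smul, Pi.smul_apply, smul_eq_mul] at h1
  have h2 := mul_le_mul_of_nonneg_left (Matrix.pow_mulVec_le hG hw.le hle l i) ha
  have h3 := mul_le_mul_of_nonneg_left (hhb i) (mul_nonneg ha (pow_pos hw l).le)
  linarith

theorem le_levelOp_pow_mulVec {z : ℝ} {G : Matrix S S ℝ} (hG : M.IsNonnegSol1 z G) {u : S → ℝ}
    (hu : ∀ i, u i ≤ (M.C1 z G *ᵥ u) i) (l : ℕ) (i : S) :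
    ((G ^ l) *ᵥ u) i ≤ M.levelOp z (fun l => (G ^ l) *ᵥ u) l i := by
  rw [levelOp_apply]
  cases l with
  | zero =>
    rw [levelStep_pow_mulVec_zero, pow_zero, Matrix.one_mulVec]
    exact hu i
  | succ l => rw [levelStep_pow_mulVec hG]

/-- Maximum principle for the process without the boundary `x₁ = 0`. -/
theorem isUnit_one_sub_C1_one (hFree1 : ChainIrreducible M.PFree1) {G : Matrix S S ℝ}
    (hG : M.IsNonnegSol1 1 G) {h : S → ℝ} (hh : ∀ i, 0 < h i) {w : ℝ} (hw : 0 < w) (hw1 : w < 1)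
    (hle : ∀ i, (G *ᵥ h) i ≤ w * h i) : IsUnit (1 - M.C1 1 G) := by
  by_contra hsing
  obtain ⟨u, hu0, ⟨j, hj⟩, hu⟩ :=
    exists_nonneg_le_mulVec_of_not_isUnit (C1_nonneg zero_le_one hG.1) hsing
  obtain ⟨c, hc, hbound⟩ := exists_pow_mulVec_le hG.1 hh hw hle u
  set y : ℕ → S → ℝ := fun l => (G ^ l) *ᵥ u with hy
  have hlim : Tendsto (fun l : ℕ => c * w ^ l) atTop (𝓝 (c * 0)) :=
    (tendsto_pow_atTop_nhds_zero_of_lt_one hw.le hw1).const_mul c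
  rw [mul_zero] at hlim
  obtain ⟨L, hL⟩ := eventually_atTop.1 (hlim.eventually_lt_const hj)
  have hy0 : y 0 j = u j := by simp [hy]
  obtain ⟨q, -, hq⟩ := Finset.exists_max_image
    (Finset.range (L + 1) ×ˢ (Finset.univ : Finset S)) (fun q => y q.1 q.2)
    ⟨(0, j), by simp⟩
  have hmax : ∀ l i, y l i ≤ y q.1 q.2 := by
    intro l i
    rcases lt_or_ge l (L + 1) with hl | hl
    · exact hq (l, i) (by simp [hl])
    · have h1 : y l i < y 0 j := by
        rw [hy0]
        exact (hbound l i).trans_lt (hL l (by omega))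
      exact h1.le.trans (hq (0, j) (by simp))
  have hedge : ∀ x x' : ℤ × ℕ × S, 0 < M.PFree1 x x' →
      y x.2.1 x.2.2 = y q.1 q.2 → y x'.2.1 x'.2.2 = y q.1 q.2 := by
    rintro ⟨a, l, i⟩ ⟨b, l', i'⟩ hpos hx
    obtain ⟨k, hk, -⟩ := exists_P_pos_of_PFree1_pos hpos
    have hker := isFiniteStochastic_P (M := M)
    refine hker.eq_of_kernelMean_le (x := (1, l, i)) (y := (k, l', i'))
      (f := fun x : ℕ × ℕ × S => y x.2.1 x.2.2) (g := fun _ => y q.1 q.2)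
      (fun x => hmax _ _) ?_ hk
    rw [hker.kernelMean_const]
    have h1 := le_levelOp_pow_mulVec hG hu l i
    have h2 := mul_levelOp_eq_kernelMean (M := M) one_ne_zero y l i
    simp only [one_pow, one_mul] at h2
    rw [← h2]
    exact hx.ge.trans h1
  obtain ⟨n, hn⟩ := hFree1 (0, q.1, q.2) (0, L, j)
  have h1 := hn.induction_forward (Q := fun x => y x.2.1 x.2.2 = y q.1 q.2) hedge rfl
  have h2 : y L j < y 0 j := by
    rw [hy0]
    exact (hbound L j).trans_lt (hL L le_rfl)
  exact absurd (hmax 0 j) (not_le.2 (h1 ▸ h2))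

theorem isUnit_one_sub_C1_of_one_lt [Nonempty S] (hP : ChainIrreducible M.P)
    (hFree1 : ChainIrreducible M.PFree1) {ν : ℕ → ℕ → S → ℝ} (hν : M.IsStationary ν)
    {z : ℝ} (hz : 1 < z) {G : Matrix S S ℝ} (hG : M.IsNonnegSol1 z G) {h : S → ℝ}
    (hh : ∀ i, 0 < h i) {w : ℝ} (hw : 0 < w) (hle : ∀ i, (G *ᵥ h) i ≤ w * h i)
    (hs : Summable fun x : ℕ × ℕ × S => ν x.1 x.2.1 x.2.2 * (z ^ x.1 * w ^ x.2.1))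
    {w₁ : ℝ} (hww : w < w₁) {g : S → ℝ} (hg : M.IsStrictSubinvariant z w₁ g) :
    IsUnit (1 - M.C1 z G) := by
  by_contra hsing
  have hz0 : 0 < z := one_pos.trans hz
  have hw₁ : 0 < w₁ := hw.trans hww
  obtain ⟨u, hu0, ⟨j, hj⟩, hu⟩ :=
    exists_nonneg_le_mulVec_of_not_isUnit (C1_nonneg hz0.le hG.1) hsing
  obtain ⟨c, hc, hbound⟩ := exists_pow_mulVec_le hG.1 hh hw hle u
  set y : ℕ → S → ℝ := fun l => (G ^ l) *ᵥ u with hy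
  have hy0 : ∀ l i, 0 ≤ y l i := fun l =>
    Matrix.mulVec_apply_nonneg (Matrix.pow_apply_nonneg hG.1 l) hu0
  have hyj : 0 < y 0 j := by simpa [hy] using hj
  have hysub : ∀ l i, y l i ≤ M.levelOp z y l i := le_levelOp_pow_mulVec hG hu
  have hev := hg.eventually hz0.ne' hw₁.ne'
  obtain ⟨a, ha, hga⟩ : ∃ a, 0 < a ∧ ∀ i, a ≤ g i := by
    obtain ⟨i, -, hi⟩ := Finset.exists_min_image Finset.univ g Finset.univ_nonempty
    exact ⟨g i, hg.1 i, fun i' => hi i' (Finset.mem_univ _)⟩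
  set b : ℕ → S → ℝ := fun l => w₁ ^ l • g with hb
  have hba : ∀ l i, a * w₁ ^ l ≤ b l i := fun l i => by
    rw [mul_comm]
    exact mul_le_mul_of_nonneg_left (hga i) (pow_pos hw₁ l).le
  have hbsup : ∀ {z₁ : ℝ}, M.IsStrictSubinvariant z₁ w₁ g →
      ∀ l i, M.levelOp z₁ b (l + 1) i ≤ b (l + 1) i := by
    intro z₁ h₁ l i
    rw [levelOp_apply, hb, levelStep_pow_succ hw₁.ne']
    exact mul_le_mul_of_nonneg_left (h₁.2 i).le (pow_pos hw₁ _).le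
  by_cases hharm : M.levelOp z y = y
  · have hypos : ∀ l i, 0 < y l i := by
      intro l i
      obtain ⟨n, hn⟩ := hFree1 (0, l, i) (0, 0, j)
      have hfix : (M.levelOp z ^ n) y = y := by
        clear hn
        induction n with
        | zero => rfl
        | succ n ih => rw [pow_succ, Module.End.mul_apply, hharm, ih]
      have := levelOp_pow_pos_of_reachIn hz0 hy0 hn hyj
      rwa [hfix] at this
    obtain ⟨r, ⟨⟨hr, hr0⟩, hr1⟩⟩ : ∃ r : ℝ, (M.IsStrictSubinvariant (z ^ r) w₁ g ∧ 0 < r) ∧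
        r < 1 := by
      have hcont : Tendsto (fun r : ℝ => (z ^ r, w₁)) (𝓝 1) (𝓝 (z, w₁)) := by
        have h1 : ContinuousAt (fun r : ℝ => z ^ r) 1 := Real.continuousAt_const_rpow hz0.ne'
        have h2 : Tendsto (fun r : ℝ => z ^ r) (𝓝 1) (𝓝 z) := by
          simpa using h1.tendsto
        exact h2.prodMk_nhds tendsto_const_nhds
      have h3 := (hcont.eventually hev).and (lt_mem_nhds one_pos)
      exact ((h3.filter_mono nhdsWithin_le_nhds).and
        (self_mem_nhdsWithin (s := Set.Iio (1 : ℝ)))).exists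
    have hzr : 0 < z ^ r := Real.rpow_pos_of_pos hz0 r
    have hzrz : z ^ r < z := by
      simpa using Real.rpow_lt_rpow_of_exponent_lt hz hr1
    obtain ⟨hη, l₀, i₀, hη₀⟩ := levelOp_rpow_le hFree1 hz hypos hharm hr0 hr1
    set η : ℕ → S → ℝ := fun l i => y l i ^ r with hηdef
    have hηpos : ∀ l i, 0 ≤ η l i := fun l i => (Real.rpow_pos_of_pos (hypos l i) r).le
    obtain ⟨n, hn, hn0⟩ := exists_sum_levelOp_pow_strict (M := M) hFree1 hzr (y := -η)
      (l₀ := l₀) (i₀ := i₀) (fun l i => by rw [map_neg]; exact neg_le_neg (hη l i))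
      (by rw [map_neg]; exact neg_lt_neg hη₀)
    set t : ℕ → S → ℝ := ∑ m ∈ Finset.range (n + 1), (M.levelOp (z ^ r) ^ m) η with ht
    have htneg : ∑ m ∈ Finset.range (n + 1), (M.levelOp (z ^ r) ^ m) (-η) = -t := by
      simp only [map_neg, Finset.sum_neg_distrib, ht]
    rw [htneg, map_neg] at hn hn0
    have htsup : ∀ l i, M.levelOp (z ^ r) t l i ≤ t l i := fun l i => neg_le_neg_iff.1 (hn l i)
    have htsup0 : ∀ i, 0 < t 0 i - M.levelOp (z ^ r) t 0 i := fun i =>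
      sub_pos.2 (neg_lt_neg_iff.1 (hn0 i))
    have ht0 : ∀ l i, 0 ≤ t l i := fun l i => by
      rw [ht, Finset.sum_apply, Finset.sum_apply]
      exact Finset.sum_nonneg fun m _ => levelOp_pow_nonneg hzr hηpos m l i
    obtain ⟨B, hB, hBle⟩ := exists_nonneg_le_mul
      (fun i => M.levelOp (z ^ r) b 0 i - b 0 i) htsup0
    refine hν.false_of_subharmonic hP hz hzr hzrz hw hww hs hc ha hbound hyj
      (v := B • t + b) (fun l i => ?_) fun k l i => ?_
    · exact (hba l i).trans (le_add_of_nonneg_left (mul_nonneg hB (ht0 l i)))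
    · rw [hharm, map_add, map_smul]
      refine sub_le_sub_left (mul_le_mul_of_nonneg_left ?_ (pow_pos hzr _).le) _
      simp only [Pi.add_apply, Pi.smul_apply, smul_eq_mul]
      cases l with
      | zero => have := hBle i; linarith
      | succ l => exact add_le_add (mul_le_mul_of_nonneg_left (htsup _ i) hB) (hbsup hr l i)
  · obtain ⟨l₀, i₀, hlt⟩ : ∃ l i, y l i < M.levelOp z y l i := by
      by_contra! hcon
      exact hharm (funext fun l => funext fun i => le_antisymm (hcon l i) (hysub l i))
    obtain ⟨n, hn, hn0⟩ := exists_sum_levelOp_pow_strict hFree1 hz0 hysub hlt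
    obtain ⟨c', hc', hbound'⟩ := exists_sum_levelOp_pow_le (M := M) hz0 hw hc hbound (n + 1)
    set t : ℕ → S → ℝ := ∑ m ∈ Finset.range (n + 1), (M.levelOp z ^ m) y with ht
    have hyt : ∀ l i, y l i ≤ t l i := fun l i => by
      rw [ht, Finset.sum_apply, Finset.sum_apply]
      exact Finset.single_le_sum (f := fun m => (M.levelOp z ^ m) y l i)
        (fun m _ => levelOp_pow_nonneg hz0 hy0 m l i) (Finset.mem_range.2 (Nat.succ_pos n))
    obtain ⟨z₁, ⟨⟨hz₁, hz₁0⟩, hz₁z⟩⟩ : ∃ z₁ : ℝ, (M.IsStrictSubinvariant z₁ w₁ g ∧ 0 < z₁) ∧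
        z₁ < z := by
      have hcont : Tendsto (fun z₁ : ℝ => (z₁, w₁)) (𝓝 z) (𝓝 (z, w₁)) :=
        tendsto_id.prodMk_nhds tendsto_const_nhds
      have h3 := (hcont.eventually hev).and (lt_mem_nhds hz0)
      exact ((h3.filter_mono nhdsWithin_le_nhds).and
        (self_mem_nhdsWithin (s := Set.Iio z))).exists
    obtain ⟨D, hD, hDle⟩ := exists_nonneg_le_mul (fun i => M.levelOp z₁ b 0 i - b 0 i)
      (fun i => sub_pos.2 (hn0 i))
    have hD1 : 0 ≤ D + 1 := by linarith
    refine hν.false_of_subharmonic hP hz hz₁0 hz₁z hw hww hs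
      (u := (D + 1) • t) (v := b) (c := (D + 1) * c') (j := j) (mul_nonneg hD1 hc') ha
      (fun l i => ?_)
      (mul_pos (by linarith) (hyj.trans_le (hyt 0 j))) hba fun k l i => ?_
    · rw [mul_assoc]
      exact mul_le_mul_of_nonneg_left (hbound' l i) hD1
    · rw [map_smul]
      simp only [Pi.smul_apply, smul_eq_mul]
      have hzk := pow_pos hz0 (k + 1)
      have hz₁k := pow_pos hz₁0 (k + 1)
      have hmono : z₁ ^ (k + 1) ≤ z ^ (k + 1) := pow_le_pow_left₀ hz₁0.le hz₁z.le _
      have hpos : 0 ≤ (D + 1) * (M.levelOp z t l i - t l i) :=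
        mul_nonneg hD1 (sub_nonneg.2 (hn l i))
      have hkey : M.levelOp z₁ b l i - b l i ≤ (D + 1) * (M.levelOp z t l i - t l i) := by
        cases l with
        | zero => have := hDle i; have := hn0 i; linarith
        | succ l => exact (sub_nonpos.2 (hbsup hz₁ l i)).trans hpos
      have e1 := mul_le_mul_of_nonneg_left hkey hz₁k.le
      have e2 := mul_le_mul_of_nonneg_right hmono hpos
      linarith

end Nonsingular

end QBD2

theorem lemma3p3 {S : Type*} [Fintype S] [DecidableEq S] (M : QBD2 S)
    (hP : ChainIrreducible M.P) (hP' : ChainAperiodic M.P)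
    (hFree : ChainIrreducible M.PFree) (hFree' : ChainAperiodic M.PFree)
    (hFree1 : ChainIrreducible M.PFree1) (hFree1' : ChainAperiodic M.PFree1)
    (hFree2 : ChainIrreducible M.PFree2) (hFree2' : ChainAperiodic M.PFree2)
    (ν : ℕ → ℕ → S → ℝ) (hν : M.IsStationary ν)
    (z : ℝ) (hz : z ∈ Set.Icc M.zLow1 M.zHigh1)
    (hD : (z, M.zetaLow2 z) ∈ M.D1 ν) :
    ∃ G : Matrix S S ℝ, M.IsG1 z G ∧
      Summable (phi1Term ν z) ∧ Summable (phi2Term ν G) ∧ Summable (phi2C2hatTerm M ν z G) ∧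
      phi1 ν z ᵥ* (1 - M.C1 z G) =
        phi2C2hat M ν z G - phi2 ν G + ν 0 0 ᵥ* (M.C0 z G - 1) ∧
      (1 ≤ z → (z, M.zetaLow2 z) ≠ (1, 1) → IsUnit (1 - M.C1 z G)) ∧
      (IsUnit (1 - M.C1 z G) →
        phi1 ν z =
          (phi2C2hat M ν z G - phi2 ν G + ν 0 0 ᵥ* (M.C0 z G - 1)) ᵥ* (1 - M.C1 z G)⁻¹) := by
  have hS : Nonempty S := by
    rcases isEmpty_or_nonempty S with hS | hS
    · have h0 := hν.hasSum_one.unique hasSum_empty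
      exact absurd h0 one_ne_zero
    · exact hS
  have hz0 : 0 < z := (Real.exp_pos _).trans_le hz.1
  obtain ⟨-, -, ⟨z', w'⟩, ⟨hz'0, -, hw'0, -, hlt⟩, hzz, -⟩ := id hD
  simp only at hz'0 hw'0 hlt hzz
  obtain ⟨hleast, hchi⟩ := QBD2.isLeast_zetaLow2_of_zLow1_le hFree hz.1 hzz hw'0 hlt
  obtain ⟨-, hw0, h, hh⟩ := hleast.1
  have hsum := hν.summable_of_mem_D1 hD
  obtain ⟨G, hG, hGh⟩ := QBD2.exists_isG1 hz0.le hw0 hh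
  simp only at hw0 hh hGh
  have hs : ∀ v : S → ℝ, Summable fun x : ℕ × ℕ × S =>
      ν x.1 x.2.1 x.2.2 * |z ^ x.1 * ((G ^ x.2.1) *ᵥ v) x.2.2| := by
    intro v
    obtain ⟨c, hc, hbound⟩ := QBD2.exists_pow_mulVec_le hG.1.1 hh.1 hw0 hGh fun i => |v i|
    refine Summable.of_nonneg_of_le (fun x => mul_nonneg (hν.nonneg _ _ _) (abs_nonneg _))
      (fun x => ?_) (hsum.mul_left c)
    have h1 : |((G ^ x.2.1) *ᵥ v) x.2.2| ≤ c * M.zetaLow2 z ^ x.2.1 := by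
      refine le_trans ?_ (hbound x.2.1 x.2.2)
      refine (Finset.abs_sum_le_sum_abs _ _).trans (Finset.sum_le_sum fun j _ => ?_)
      rw [abs_mul, abs_of_nonneg (Matrix.pow_apply_nonneg hG.1.1 _ _ _)]
    rw [abs_mul, abs_of_pos (pow_pos hz0 _)]
    have h2 := mul_le_mul_of_nonneg_left h1
      (mul_nonneg (hν.nonneg x.1 x.2.1 x.2.2) (pow_pos hz0 x.1).le)
    linarith
  have hid := QBD2.phi1_vecMul_eq hν hz0 hG.1 hs
  refine ⟨G, hG, QBD2.summable_phi1Term hz0 hs, QBD2.summable_phi2Term hν hs,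
    QBD2.summable_phi2C2hatTerm hν hs, hid, fun hz1 hne => ?_, fun hunit => ?_⟩
  · rcases hz1.eq_or_lt with rfl | hz1
    · have hle : M.zetaLow2 1 ≤ 1 :=
        hleast.2 ⟨one_pos, one_pos, _, QBD2.isSubinvariant_one⟩
      exact QBD2.isUnit_one_sub_C1_one hFree1 hG.1 hh.1 hw0
        (hle.lt_of_ne fun h1 => hne (by rw [h1])) hGh
    · obtain ⟨w₁, g, hww, hg⟩ :=
        QBD2.exists_isStrictSubinvariant_of_one_lt hz1 hzz hw'0 hlt hleast hchi
      exact QBD2.isUnit_one_sub_C1_of_one_lt hP hFree1 hν hz1 hG.1 hh.1 hw0 hGh hsum hww hg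
  · rw [← hid, Matrix.vecMul_vecMul,
      Matrix.mul_nonsing_inv _ ((Matrix.isUnit_iff_isUnit_det _).1 hunit), Matrix.vecMul_one]
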